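/- For a context-free grammar $G=(V,\Sigma,P,S)$ let $\mathrm{Symb}(G)=\sum_{(A\to\alpha)\in P}(2+|\alpha|)$. There is a constant $K$, and for every $m\ge 1$ a constant $C=C(m)$, such that the following holds. Let $\Sigma=\{a_1,\dots,a_m\}$ be an alphabet with $m$ letters and let $G$ be an arbitrary context-free grammar with terminal alphabet $\Sigma$ and $\mathrm{Symb}(G)=h$ that generates a letter-bounded language $L(G)\subseteq a_1^*a_2^*\cdots a_m^*$. Then there is an $(m-1)$-turn pushdown automaton $M$ in normal form, with $T(M)=L(G)$, at most $2^{Ch}$ states and at most $K$ stack symbols (that is, $2^{O(h)}$ states and $O(1)$ stack symbols). Here $T(M)$ is the set of words on which $M$, started in its initial state with only the bottom symbol $Z_0$ on the stack, can read the whole input and reach a final state. $M$ is in normal form if $Z_0$ is never pushed or popped, whenever all input is read and the state is final the stack contains only $Z_0$, moves that read an input letter do not change the stack, and every other move leaves the stack unchanged, pops one symbol, or pushes one symbol. A sequence of configurations is one-turn if its stack heights are first non-decreasing with at least one strict increase and then non-increasing with at least one strict decrease. $M$ is $k$-turn if every $w\in T(M)$ is accepted by a computation with at most $k$ turns, i.e.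 one that either makes no turn (no increase of the stack height is ever followed by a decrease) or is a concatenation of at most $k$ one-turn sequences. -/

import Mathlib

/-- The size measure `Symb(G) = ∑_{(A → α) ∈ P} (2 + |α|)` of a context-free grammar. -/
def ContextFreeGrammar.symb {T : Type*} (G : ContextFreeGrammar T) : ℕ :=
  ∑ r ∈ G.rules, (2 + r.output.length)

/-- The language `a₁* a₂* ⋯ aₘ*` over the alphabet `{a₁, …, aₘ}`; the letters are the elements
of `Fin m`, in increasing order. -/
def letterBoundedWords (m : ℕ) : Language (Fin m) :=
  ((List.finRange m).map fun i => KStar.kstar ({[i]} : Language (Fin m))).prod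

/-- A (nondeterministic) pushdown automaton with input alphabet `α`, states `Q` and stack symbols
`Γ`. `(p, β) ∈ δ q a Z` means: in state `q` with `Z` on top of the stack, reading `a`
(`a = none` for a move without input), the automaton may go to state `p` and replace `Z` by `β`,
whose first symbol becomes the topmost one. -/
structure PDA (α Q Γ : Type*) where
  δ : Q → Option α → Γ → Set (Q × List Γ)
  finite_δ : ∀ q a Z, (δ q a Z).Finite
  q₀ : Q
  Z₀ : Γ
  F : Set Q

namespace PDA

/-- A configuration: state, unread part of the input, stack (topmost symbol first). -/
@[ext] structure Config (α Q Γ : Type*) where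
  state : Q
  input : List α
  stack : List Γ

/-- One move `(q, aw, Zγ) ⊢ (p, w, βγ)` with `(p, β) ∈ δ q a Z`. -/
def Step {α Q Γ : Type*} (M : PDA α Q Γ) (c c' : Config α Q Γ) : Prop :=
  ∃ (a : Option α) (Z : Γ) (β γ : List Γ), (c'.state, β) ∈ M.δ c.state a Z ∧
    c.input = a.toList ++ c'.input ∧ c.stack = Z :: γ ∧ c'.stack = β ++ γ

/-- The initial configuration `(q₀, w, Z₀)`. -/
def init {α Q Γ : Type*} (M : PDA α Q Γ) (w : List α) : Config α Q Γ := ⟨M.q₀, w, [M.Z₀]⟩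

/-- A configuration with a final state and no unread input. -/
def IsAccepting {α Q Γ : Type*} (M : PDA α Q Γ) (c : Config α Q Γ) : Prop :=
  c.state ∈ M.F ∧ c.input = []

/-- The language `T(M)` accepted with accepting states. -/
def accepts {α Q Γ : Type*} (M : PDA α Q Γ) : Language α :=
  {w | ∃ c, Relation.ReflTransGen M.Step (M.init w) c ∧ M.IsAccepting c}

/-- The normal form for pushdown automata: `Z₀` is never pushed or popped; an accepting
configuration that is reached has only `Z₀` on its stack; a move that reads input leaves the stack
unchanged; a move without input leaves the stack unchanged, pops one symbol or pushes one symbol. -/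
structure IsNormalForm {α Q Γ : Type*} (M : PDA α Q Γ) : Prop where
  accept_stack : ∀ (w : List α) (c : Config α Q Γ),
    Relation.ReflTransGen M.Step (M.init w) c → M.IsAccepting c → c.stack = [M.Z₀]
  read : ∀ (q p : Q) (a : α) (Z : Γ) (β : List Γ), (p, β) ∈ M.δ q (some a) Z → β = [Z]
  eps : ∀ (q p : Q) (Z : Γ) (β : List Γ), (p, β) ∈ M.δ q none Z →
    β = [Z] ∨ (β = [] ∧ Z ≠ M.Z₀) ∨ ∃ B, B ≠ M.Z₀ ∧ β = [B, Z]

/-- The stack heights `H s, …, H e` make exactly one turn: they do not decrease up to an index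
`j`, with at least one strict increase, and do not increase afterwards, the first step after `j`
being a strict decrease. -/
def IsOneTurn (H : ℕ → ℕ) (s e : ℕ) : Prop :=
  ∃ p j, s ≤ p ∧ p < j ∧ j < e ∧
    MonotoneOn H (Set.Icc s j) ∧ H p < H (p + 1) ∧
    H (j + 1) < H j ∧ AntitoneOn H (Set.Icc j e)

/-- The stack heights `H 0, …, H n` make no turn: no increase is followed later by a decrease. -/
def IsTurnFree (H : ℕ → ℕ) (n : ℕ) : Prop :=
  ∀ p q, p < q → q < n → H p < H (p + 1) → H q ≤ H (q + 1)

/-- The stack heights `H 0, …, H n` make at most `k` turns: there is no turn at all, or the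
sequence splits into at most `k` consecutive one-turn pieces. -/
def IsKTurnSeq (k : ℕ) (H : ℕ → ℕ) (n : ℕ) : Prop :=
  IsTurnFree H n ∨
    ∃ l ≤ k, ∃ i : ℕ → ℕ, i 0 = 0 ∧ i l = n ∧ ∀ j < l, IsOneTurn H (i j) (i (j + 1))

/-- `M` is a `k`-turn pushdown automaton: every accepted word is accepted by a `k`-turn sequence
of configurations `c 0 ⊢ c 1 ⊢ ⋯ ⊢ c n`. -/
def IsKTurn {α Q Γ : Type*} (M : PDA α Q Γ) (k : ℕ) : Prop :=
  ∀ w ∈ M.accepts, ∃ (n : ℕ) (c : ℕ → Config α Q Γ),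
    c 0 = M.init w ∧ (∀ i < n, M.Step (c i) (c (i + 1))) ∧ M.IsAccepting (c n) ∧
    IsKTurnSeq k (fun i => (c i).stack.length) n

end PDA

/-!
A letter-bounded word is sorted, hence determined by its Parikh vector (a `Multiset` here), and so
it is enough to describe the vectors of the language and to produce them in the order of the
letters.

*Vectors of the language.* Let `X` be the set of nonterminals of a parse tree. A loop `A ⇒⁺ u A v`
with `A ∈ X` that uses only nonterminals of `X` can be inserted into the tree arbitrarily often
without changing `X`. Conversely, up to the order of the letters in the yield, every parse tree
arises from one without repeated nonterminals on a path by inserting small loops one at a time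
(`ContextFreeGrammar.Yields.exists_grow`), where "small" means of length `2 ^ O(h)` for a grammar
of size `h` (`ContextFreeGrammar.SimpleYields.length_le`). At most `h` of these insertions enlarge
the set of nonterminals; together with the initial tree they give a base vector with entries `2 ^
O(h)`, and all other loops are of the free kind just described
(`ContextFreeGrammar.Yields.exists_base`). So the language is given by `2 ^ O(h)` pairs of a base
vector and a set `X`, to which loops free for `X` may be added.

*Shape of the loops.* Since pumped words are sorted, the two parts of a loop are powers of single
letters `i ≤ j` (`ContextFreeGrammar.exists_loopItem`). Two loops of one parse tree lie side by
side or nested, so that pairs `i < j` of different loops never cross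
(`ContextFreeGrammar.loopItems_not_cross`).

*The automaton.* It guesses a base vector and a set `X` and goes through the letters in order. At
the letter `i` it reads the base entry, then pops the symbols whose target is `i`, reading one
letter for each, and then uses loops with first letter `i`: it reads the first part and pushes one
symbol for each letter of the second part. The state holds two bounded counters and the set of the
targets that occur on the stack; the targets are sorted along the stack, so it suffices to mark
the lowest symbol of each target, and two symbols are enough besides the bottom one. Soundness is
an invariant (`PDA.VectorFamily.Inv`). For completeness, pairs do not cross, and so using the
loops of a letter in decreasing order of their second letters keeps the targets sorted
(`PDA.VectorFamily.AtStart.atEnd`). In such a computation the stack falls and then rises once for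
each letter. It cannot fall at the first letter and cannot rise at the last one, which leaves at
most `m - 1` turns (`PDA.Phased.isKTurnSeq`).
-/

/-! ### Parse forests -/

namespace ContextFreeGrammar

open scoped List

open Classical in
/-- `G.Yields s w X`: some forest of parse trees with roots `s` has yield `w`, and `X` is the set of
nonterminals that label its nodes. -/
inductive Yields {T : Type*} (G : ContextFreeGrammar T) :
    List (Symbol T G.NT) → List T → Finset G.NT → Prop
  | nil : Yields G [] [] ∅
  | terminal {t s w X} : Yields G s w X → Yields G (.terminal t :: s) (t :: w) X
  | nonterminal {A α s u w X Y} : ⟨A, α⟩ ∈ G.rules → Yields G α u X → Yields G s w Y →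
      Yields G (.nonterminal A :: s) (u ++ w) (insert A (X ∪ Y))

open Classical in
/-- `G.SimpleYields S s w X`: as `G.Yields s w X`, for a forest in which no path from a root
repeats a nonterminal and all nonterminals belong to `S`. -/
inductive SimpleYields {T : Type*} (G : ContextFreeGrammar T) :
    Finset G.NT → List (Symbol T G.NT) → List T → Finset G.NT → Prop
  | nil {S} : SimpleYields G S [] [] ∅
  | terminal {S t s w X} : SimpleYields G S s w X →
      SimpleYields G S (.terminal t :: s) (t :: w) X
  | nonterminal {S A α s u w X Y} : A ∈ S → ⟨A, α⟩ ∈ G.rules →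
      SimpleYields G (S.erase A) α u X → SimpleYields G S s w Y →
      SimpleYields G S (.nonterminal A :: s) (u ++ w) (insert A (X ∪ Y))

open Classical in
/-- The nonterminals that have a rule. -/
noncomputable def lhs {T : Type*} (G : ContextFreeGrammar T) : Finset G.NT :=
  G.rules.image ContextFreeRule.input

open Classical in
/-- The contribution to `G.symb` of the rules of the nonterminal `A`. -/
noncomputable def weight {T : Type*} (G : ContextFreeGrammar T) (A : G.NT) : ℕ :=
  ∑ r ∈ G.rules with r.input = A, (2 + r.output.length)

open Classical in
/-- A pumping context at `A` with left part `u`, right part `v` and nonterminals `Z`: every parse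
tree with root `A` can be enclosed in a larger one, again with root `A`. -/
def Loop {T : Type*} (G : ContextFreeGrammar T) (A : G.NT) (u v : List T) (Z : Finset G.NT) :
    Prop :=
  ∀ w X, G.Yields [.nonterminal A] w X → G.Yields [.nonterminal A] (u ++ w ++ v) (X ∪ Z)

variable {T : Type*} {G : ContextFreeGrammar T}

theorem Yields.congr {s : List (Symbol T G.NT)} {w w' : List T} {X X' : Finset G.NT}
    (h : G.Yields s w X) (hw : w = w') (hX : X = X') : G.Yields s w' X' := hw ▸ hX ▸ h

theorem SimpleYields.congr {S : Finset G.NT} {s : List (Symbol T G.NT)} {w w' : List T}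
    {X X' : Finset G.NT} (h : G.SimpleYields S s w X) (hw : w = w') (hX : X = X') :
    G.SimpleYields S s w' X' := hw ▸ hX ▸ h

theorem SimpleYields.yields {S : Finset G.NT} {s : List (Symbol T G.NT)} {w : List T}
    {X : Finset G.NT} (h : G.SimpleYields S s w X) : G.Yields s w X := by
  induction h with
  | nil => exact .nil
  | terminal _ ih => exact .terminal ih
  | nonterminal _ hr _ _ ih₁ ih₂ => exact .nonterminal hr ih₁ ih₂

open Classical in
theorem Yields.append {s t : List (Symbol T G.NT)} {u v : List T} {X Y : Finset G.NT}
    (h : G.Yields s u X) (h' : G.Yields t v Y) : G.Yields (s ++ t) (u ++ v) (X ∪ Y) := by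
  induction h with
  | nil => exact h'.congr rfl (by simp)
  | terminal _ ih => exact .terminal ih
  | nonterminal hr h₁ _ _ ih =>
    exact (Yields.nonterminal hr h₁ ih).congr (by simp) (by simp)

open Classical in
theorem SimpleYields.append {S : Finset G.NT} {s t : List (Symbol T G.NT)} {u v : List T}
    {X Y : Finset G.NT} (h : G.SimpleYields S s u X) (h' : G.SimpleYields S t v Y) :
    G.SimpleYields S (s ++ t) (u ++ v) (X ∪ Y) := by
  induction h with
  | nil => exact h'.congr rfl (by simp)
  | terminal _ ih => exact .terminal (ih h')
  | nonterminal hA hr h₁ _ _ ih =>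
    exact (SimpleYields.nonterminal hA hr h₁ (ih h')).congr (by simp) (by simp)

theorem Yields.of_append {s t : List (Symbol T G.NT)} {w : List T} {X : Finset G.NT}
    (h : G.Yields (s ++ t) w X) :
    ∃ u v Y Z, G.Yields s u Y ∧ G.Yields t v Z ∧ w = u ++ v := by
  induction s generalizing w X with
  | nil => exact ⟨[], w, ∅, X, .nil, h, rfl⟩
  | cons a s ih =>
    cases h with
    | terminal h =>
      obtain ⟨u, v, Y, Z, h₁, h₂, rfl⟩ := ih h
      exact ⟨_, v, _, Z, .terminal h₁, h₂, rfl⟩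
    | nonterminal hr h₁ h₂ =>
      obtain ⟨u, v, Y, Z, h₃, h₄, rfl⟩ := ih h₂
      exact ⟨_, v, _, Z, .nonterminal hr h₁ h₃, h₄, by simp⟩

theorem yields_map_terminal (w : List T) : G.Yields (w.map .terminal) w ∅ := by
  induction w with
  | nil => exact .nil
  | cons a w ih => exact .terminal ih

theorem Yields.of_produces {s t : List (Symbol T G.NT)} {w : List T} {X : Finset G.NT}
    (h : G.Produces s t) (ht : G.Yields t w X) : ∃ Y, G.Yields s w Y := by
  obtain ⟨r, hr, h⟩ := h
  obtain ⟨p, q, rfl, rfl⟩ := h.exists_parts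
  obtain ⟨u, w₃, _, _, h₁, h₂, rfl⟩ := ht.of_append
  obtain ⟨w₁, w₂, _, _, h₃, h₄, rfl⟩ := h₁.of_append
  exact ⟨_, (h₃.append (Yields.nonterminal hr h₄ .nil)).append h₂ |>.congr (by simp) rfl⟩

theorem Yields.derives {s : List (Symbol T G.NT)} {w : List T} {X : Finset G.NT}
    (h : G.Yields s w X) : G.Derives s (w.map .terminal) := by
  induction h with
  | nil => rfl
  | terminal _ ih => exact ih.append_left [_]
  | @nonterminal A α s u w X Y hr _ _ ih₁ ih₂ =>
    have h₁ : G.Produces (.nonterminal A :: s) (α ++ s) := ⟨_, hr, .head s⟩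
    rw [List.map_append]
    exact h₁.trans_derives ((ih₁.append_right s).trans (ih₂.append_left _))

theorem mem_language_iff_exists_yields {w : List T} :
    w ∈ G.language ↔ ∃ X, G.Yields [.nonterminal G.initial] w X := by
  refine ⟨fun h => ?_, fun ⟨X, h⟩ => h.derives⟩
  rw [mem_language_iff] at h
  generalize [Symbol.nonterminal G.initial] = s at h
  induction h using Relation.ReflTransGen.head_induction_on with
  | refl => exact ⟨∅, yields_map_terminal w⟩
  | head h _ ih => exact ih.elim fun X hX => hX.of_produces h

theorem mem_lhs {A : G.NT} {α : List (Symbol T G.NT)} (h : ⟨A, α⟩ ∈ G.rules) : A ∈ G.lhs := by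
  classical exact Finset.mem_image_of_mem ContextFreeRule.input h

theorem Yields.subset_lhs {s : List (Symbol T G.NT)} {w : List T} {X : Finset G.NT}
    (h : G.Yields s w X) : X ⊆ G.lhs := by
  classical
  induction h with
  | nil => simp
  | terminal _ ih => exact ih
  | nonterminal hr _ _ ih₁ ih₂ =>
    exact Finset.insert_subset (mem_lhs hr) (Finset.union_subset ih₁ ih₂)

theorem card_lhs_le : G.lhs.card ≤ G.symb := by
  classical
  refine Finset.card_image_le.trans ?_
  rw [Finset.card_eq_sum_ones]
  exact Finset.sum_le_sum fun r _ => by omega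

theorem sum_weight : ∑ A ∈ G.lhs, G.weight A = G.symb := by
  classical
  exact Finset.sum_fiberwise_of_maps_to (fun r hr => Finset.mem_image_of_mem _ hr) _

theorem length_le_weight {A : G.NT} {α : List (Symbol T G.NT)} (h : ⟨A, α⟩ ∈ G.rules) :
    α.length ≤ G.weight A := by
  classical
  have := Finset.single_le_sum (f := fun r : ContextFreeRule T G.NT => 2 + r.output.length)
    (fun _ _ => Nat.zero_le _) (Finset.mem_filter.2 ⟨h, rfl⟩ :
      (⟨A, α⟩ : ContextFreeRule T G.NT) ∈ G.rules.filter (·.input = A))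
  exact le_trans (by simp) this

theorem weight_le_symb {A : G.NT} {α : List (Symbol T G.NT)} (h : ⟨A, α⟩ ∈ G.rules) :
    G.weight A ≤ G.symb := by
  rw [← sum_weight]
  exact Finset.single_le_sum (fun _ _ => Nat.zero_le _) (mem_lhs h)

/-- Along a path of a simple forest the numbers of children multiply to at most `2` to the total
weight of the nonterminals on the path, since these are distinct. This makes the yield only
exponential in the size of the grammar. -/
theorem SimpleYields.length_le {S : Finset G.NT} {s : List (Symbol T G.NT)} {w : List T}
    {X : Finset G.NT} (h : G.SimpleYields S s w X) :
    w.length ≤ s.length * 2 ^ ∑ A ∈ S, G.weight A := by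
  classical
  induction h with
  | nil => simp
  | @terminal S t s w X _ ih =>
    have : 1 ≤ 2 ^ ∑ A ∈ S, G.weight A := Nat.one_le_two_pow
    simp only [List.length_cons, add_mul, one_mul]
    omega
  | @nonterminal S A α s u w X Y hA hr _ _ ih₁ ih₂ =>
    have h₁ : α.length ≤ 2 ^ G.weight A := (length_le_weight hr).trans Nat.lt_two_pow_self.le
    have h₂ := Finset.add_sum_erase S G.weight hA
    simp only [List.length_cons, List.length_append, add_mul, one_mul]
    have h₃ := Nat.mul_le_mul_right (2 ^ ∑ A ∈ S.erase A, G.weight A) h₁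
    rw [← pow_add, h₂] at h₃
    omega

theorem SimpleYields.mono {S S' : Finset G.NT} {s : List (Symbol T G.NT)} {w : List T}
    {X : Finset G.NT} (h : G.SimpleYields S s w X) (hS : S ⊆ S') : G.SimpleYields S' s w X := by
  classical
  induction h generalizing S' with
  | nil => exact .nil
  | terminal _ ih => exact .terminal (ih hS)
  | nonterminal hA hr _ _ ih₁ ih₂ =>
    exact .nonterminal (hS hA) hr (ih₁ (Finset.erase_subset_erase _ hS)) (ih₂ hS)

open Classical in
theorem SimpleYields.erase {S : Finset G.NT} {s : List (Symbol T G.NT)} {w : List T}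
    {X : Finset G.NT} (h : G.SimpleYields S s w X) {A : G.NT} (hA : A ∉ X) :
    G.SimpleYields (S.erase A) s w X := by
  induction h with
  | nil => exact .nil
  | terminal _ ih => exact .terminal (ih hA)
  | nonterminal hB hr _ _ ih₁ ih₂ =>
    simp only [Finset.mem_insert, Finset.mem_union, not_or] at hA
    refine .nonterminal (Finset.mem_erase.2 ⟨Ne.symm hA.1, hB⟩) hr ?_ (ih₂ hA.2.2)
    rw [Finset.erase_right_comm]
    exact ih₁ hA.2.1

open Classical in
/-- A node labelled `A` splits a simple forest into a simple tree with root `A` and a context. -/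
theorem SimpleYields.exists_subtree {S : Finset G.NT} {s : List (Symbol T G.NT)} {w : List T}
    {X : Finset G.NT} (h : G.SimpleYields S s w X) {A : G.NT} (hA : A ∈ X) :
    ∃ u w' v X' Z, G.SimpleYields S [.nonterminal A] w' X' ∧ w = u ++ w' ++ v ∧ X = X' ∪ Z ∧
      ∀ w₁ X₁, G.Yields [.nonterminal A] w₁ X₁ → G.Yields s (u ++ w₁ ++ v) (X₁ ∪ Z) := by
  induction h with
  | nil => simp at hA
  | @terminal S t s w X _ ih =>
    obtain ⟨u, w', v, X', Z, h₁, rfl, rfl, h₂⟩ := ih hA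
    exact ⟨t :: u, w', v, X', Z, h₁, rfl, rfl, fun w₁ X₁ h => .terminal (h₂ w₁ X₁ h)⟩
  | @nonterminal S B α s u w X Y hB hr h₁ h₂ ih₁ ih₂ =>
    simp only [Finset.mem_insert, Finset.mem_union] at hA
    rcases hA with rfl | hA | hA
    · refine ⟨[], u, w, insert A X, Y, ?_, by simp, by simp, fun w₁ X₁ h => ?_⟩
      · exact (SimpleYields.nonterminal hB hr h₁ .nil).congr (by simp) (by simp)
      · exact h.append h₂.yields
    · obtain ⟨x, w', y, X', Z, h₃, rfl, rfl, h₄⟩ := ih₁ hA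
      refine ⟨x, w', y ++ w, X', insert B (Z ∪ Y), h₃.mono (Finset.erase_subset _ _), by simp,
        by simp, fun w₁ X₁ h => ?_⟩
      exact (Yields.nonterminal hr (h₄ w₁ X₁ h) h₂.yields).congr (by simp) (by simp)
    · obtain ⟨x, w', y, X', Z, h₃, rfl, rfl, h₄⟩ := ih₂ hA
      refine ⟨u ++ x, w', y, X', insert B (X ∪ Z), h₃, by simp,
        by ext; simp; tauto, fun w₁ X₁ h => ?_⟩
      exact (Yields.nonterminal hr h₁.yields (h₄ w₁ X₁ h)).congr (by simp) (by ext; simp; tauto)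

open Classical in
/-- A loop can be inserted at a node labelled `A`. -/
theorem Yields.insert_loop {s : List (Symbol T G.NT)} {w : List T} {X : Finset G.NT}
    (h : G.Yields s w X) {A : G.NT} {u v : List T} {Z : Finset G.NT} (hA : A ∈ X)
    (hl : G.Loop A u v Z) :
    ∃ w', G.Yields s w' (X ∪ Z) ∧ (w' : Multiset T) = w + u + v ∧ u ++ v <+ w' := by
  induction h with
  | nil => simp at hA
  | @terminal t s w X _ ih =>
    obtain ⟨w', h₁, h₂, h₃⟩ := ih hA
    exact ⟨_, .terminal h₁, by rw [← Multiset.cons_coe, h₂]; simp, h₃.cons _⟩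
  | @nonterminal B α s x w X Y hr h₁ h₂ ih₁ ih₂ =>
    simp only [Finset.mem_insert, Finset.mem_union] at hA
    rcases hA with rfl | hA | hA
    · refine ⟨_, (hl _ _ (Yields.nonterminal hr h₁ .nil)).append h₂ |>.congr rfl
        (by ext; simp; tauto), ?_, ?_⟩
      · simp only [← Multiset.coe_add, List.append_nil]; abel
      · simp only [List.append_nil]
        refine List.Sublist.trans ?_ (List.sublist_append_left _ _)
        exact (List.sublist_append_left u x).append (List.Sublist.refl v)
    · obtain ⟨w', h₃, h₄, h₅⟩ := ih₁ hA
      refine ⟨_, (Yields.nonterminal hr h₃ h₂).congr rfl (by ext; simp; tauto), ?_,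
        h₅.trans (List.sublist_append_left _ _)⟩
      simp only [← Multiset.coe_add, h₄]; abel
    · obtain ⟨w', h₃, h₄, h₅⟩ := ih₂ hA
      refine ⟨_, (Yields.nonterminal hr h₁ h₃).congr rfl (by simp), ?_,
        h₅.trans (List.sublist_append_right _ _)⟩
      simp only [← Multiset.coe_add, h₄]; abel

open Classical in
theorem Loop.comp {A : G.NT} {u v u' v' : List T} {Z Z' : Finset G.NT}
    (h : G.Loop A u v Z) (h' : G.Loop A u' v' Z') : G.Loop A (u ++ u') (v' ++ v) (Z ∪ Z') := by
  intro w X hw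
  exact (h _ _ (h' _ _ hw)).congr (by simp) (by ext; simp; tauto)

open Classical in
/-- Two loops can be inserted into the same forest; their parts then lie side by side or nested. -/
theorem Yields.insert_two_loops {s : List (Symbol T G.NT)} {w : List T} {X : Finset G.NT}
    (h : G.Yields s w X) {A B : G.NT} {u v u' v' : List T} {Z Z' : Finset G.NT} (hA : A ∈ X)
    (hB : B ∈ X) (hl : G.Loop A u v Z) (hl' : G.Loop B u' v' Z') :
    ∃ w' Y, G.Yields s w' Y ∧ (u ++ v ++ (u' ++ v') <+ w' ∨ u' ++ v' ++ (u ++ v) <+ w' ∨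
      u ++ (u' ++ v') ++ v <+ w' ∨ u' ++ (u ++ v) ++ v' <+ w') := by
  induction h with
  | nil => simp at hA
  | @terminal t s w X _ ih =>
    obtain ⟨w', Y, h₁, h₂⟩ := ih hA hB
    refine ⟨_, _, .terminal h₁, ?_⟩
    rcases h₂ with h | h | h | h
    exacts [.inl (h.cons _), .inr (.inl (h.cons _)), .inr (.inr (.inl (h.cons _))),
      .inr (.inr (.inr (h.cons _)))]
  | @nonterminal C α s x w X Y hr h₁ h₂ ih₁ ih₂ =>
    simp only [Finset.mem_insert, Finset.mem_union] at hA hB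
    have hC : G.Yields [.nonterminal C] x (insert C X) :=
      (Yields.nonterminal hr h₁ .nil).congr (by simp) (by simp)
    -- `C` is the root of the first tree: its loop encloses anything inserted in that tree
    have root {u v u' v' : List T} {Z Z' : Finset G.NT} {B : G.NT} (hl : G.Loop C u v Z)
        (hl' : G.Loop B u' v' Z') (hB : B ∈ insert C X) :
        ∃ w' Y, G.Yields (.nonterminal C :: s) w' Y ∧ u ++ (u' ++ v') ++ v <+ w' := by
      obtain ⟨x', hx, -, hx'⟩ := hC.insert_loop hB hl'
      exact ⟨_, _, (hl _ _ hx).append h₂, (((List.Sublist.refl u).append hx').append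
        (List.Sublist.refl v)).trans (List.sublist_append_left _ _)⟩
    -- the loops belong to the first tree and to the rest of the forest, respectively
    have side {u v u' v' : List T} {Z Z' : Finset G.NT} {A B : G.NT} (hl : G.Loop A u v Z)
        (hl' : G.Loop B u' v' Z') (hA : A ∈ insert C X) (hB : B ∈ Y) :
        ∃ w' Y, G.Yields (.nonterminal C :: s) w' Y ∧ u ++ v ++ (u' ++ v') <+ w' := by
      obtain ⟨x', hx, -, hx'⟩ := hC.insert_loop hA hl
      obtain ⟨w', hw, -, hw'⟩ := h₂.insert_loop hB hl'
      exact ⟨_, _, hx.append hw, hx'.append hw'⟩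
    have tree {D : G.NT} (hD : D = C ∨ D ∈ X ∨ D ∈ Y) (h : D ∉ Y) : D ∈ insert C X :=
      Finset.mem_insert.2 (hD.imp_right fun h' => h'.resolve_right h)
    by_cases hAY : A ∈ Y
    · by_cases hBY : B ∈ Y
      · obtain ⟨w', Y', h₃, h₄⟩ := ih₂ hAY hBY
        refine ⟨_, _, .nonterminal hr h₁ h₃, ?_⟩
        have (l : List T) (h : l <+ w') : l <+ x ++ w' :=
          h.trans (List.sublist_append_right _ _)
        exact h₄.imp (this _) (.imp (this _) (.imp (this _) (this _)))
      · obtain ⟨w', Y', h₃, h₄⟩ := side hl' hl (tree hB hBY) hAY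
        exact ⟨w', Y', h₃, .inr (.inl h₄)⟩
    · by_cases hBY : B ∈ Y
      · obtain ⟨w', Y', h₃, h₄⟩ := side hl hl' (tree hA hAY) hBY
        exact ⟨w', Y', h₃, .inl h₄⟩
      · by_cases hAC : A = C
        · subst hAC
          obtain ⟨w', Y', h₃, h₄⟩ := root hl hl' (tree hB hBY)
          exact ⟨w', Y', h₃, .inr (.inr (.inl h₄))⟩
        · by_cases hBC : B = C
          · subst hBC
            obtain ⟨w', Y', h₃, h₄⟩ := root hl' hl (tree hA hAY)
            exact ⟨w', Y', h₃, .inr (.inr (.inr h₄))⟩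
          · obtain ⟨w', Y', h₃, h₄⟩ := ih₁ ((hA.resolve_left hAC).resolve_right hAY)
              ((hB.resolve_left hBC).resolve_right hBY)
            refine ⟨_, _, .nonterminal hr h₃ h₂, ?_⟩
            have (l : List T) (h : l <+ w') : l <+ w' ++ w :=
              h.trans (List.sublist_append_left _ _)
            exact h₄.imp (this _) (.imp (this _) (.imp (this _) (this _)))

/-! ### Decomposition into a small tree and small loops -/

open Classical in
/-- One step of growth for pairs of a set of nonterminals and a Parikh vector: a small loop, rooted
in the set, contributes its nonterminals and its letters. -/
def Grow (G : ContextFreeGrammar T) (x y : Finset G.NT × Multiset T) : Prop :=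
  ∃ A ∈ x.1, ∃ u v Z, G.Loop A u v Z ∧ u.length + v.length ≤ 2 ^ (2 * G.symb) ∧
    y = (x.1 ∪ Z, x.2 + u + v)

open Classical in
theorem Grow.union {x y : Finset G.NT × Multiset T} (h : Relation.ReflTransGen G.Grow x y)
    (Y : Finset G.NT) (c : Multiset T) :
    Relation.ReflTransGen G.Grow (x.1 ∪ Y, x.2 + c) (y.1 ∪ Y, y.2 + c) := by
  refine Relation.ReflTransGen.lift (fun z => (z.1 ∪ Y, z.2 + c)) ?_ _ _ h
  rintro a b ⟨A, hA, u, v, Z, hl, hn, rfl⟩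
  exact ⟨A, Finset.mem_union_left _ hA, u, v, Z, hl, hn,
    Prod.ext (Finset.union_right_comm _ _ _) (by simp only; abel)⟩

open Classical in
/-- Every forest arises, up to the order of the letters in its yield, from a simple forest by
inserting small loops one after another. By induction on the forest: if the root label occurs again
in the simple forest found below the root, everything between the two occurrences is cut out as one
more small loop. -/
theorem Yields.exists_grow {s : List (Symbol T G.NT)} {w : List T} {X : Finset G.NT}
    (h : G.Yields s w X) : ∃ w₀ X₀, G.SimpleYields G.lhs s w₀ X₀ ∧
      Relation.ReflTransGen G.Grow (X₀, (w₀ : Multiset T)) (X, (w : Multiset T)) := by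
  induction h with
  | nil => exact ⟨_, _, .nil, .refl⟩
  | @terminal t s w X _ ih =>
    obtain ⟨w₀, X₀, h₁, h₂⟩ := ih
    refine ⟨_, _, .terminal h₁, ?_⟩
    have := Grow.union h₂ ∅ {t}
    simpa only [Finset.union_empty, Multiset.add_comm _ {t}, Multiset.singleton_add,
      Multiset.cons_coe] using this
  | @nonterminal A α s u w X Y hr h₁ h₂ ih₁ ih₂ =>
    obtain ⟨u₀, X₀, hu, gu⟩ := ih₁
    obtain ⟨w₀, Y₀, hw, gw⟩ := ih₂
    have g₁ : Relation.ReflTransGen G.Grow (insert A (X₀ ∪ Y₀), ((u₀ ++ w₀ : List T) : Multiset T))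
        (insert A (X ∪ Y), ((u ++ w : List T) : Multiset T)) := by
      have g₂ := Grow.union gu (insert A Y₀) w₀
      have g₃ := Grow.union gw (insert A X) u
      simp only [Finset.union_insert, Multiset.coe_add] at g₂ g₃
      rw [← Multiset.coe_add, ← Multiset.coe_add, Multiset.add_comm (w₀ : Multiset T),
        Multiset.add_comm (w : Multiset T), Finset.union_comm Y₀, Finset.union_comm Y] at g₃
      exact g₂.trans g₃
    by_cases hA : A ∈ X₀
    · obtain ⟨x, u', y, X', Z, h₃, rfl, rfl, h₄⟩ := hu.exists_subtree hA
      refine ⟨_, _, h₃.append hw, .head ⟨A, ?_, x, y, insert A Z, ?_, ?_, rfl⟩ ?_⟩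
      · cases h₃; simp
      · intro w₁ X₁ h
        exact (Yields.nonterminal hr (h₄ _ _ h) .nil).congr (by simp) (by simp)
      · have h₅ := hu.length_le
        rw [sum_weight] at h₅
        have h₆ : α.length ≤ 2 ^ G.symb :=
          ((length_le_weight hr).trans (weight_le_symb hr)).trans Nat.lt_two_pow_self.le
        have h₇ := Nat.mul_le_mul_right (2 ^ G.symb) h₆
        rw [two_mul, pow_add]
        simp only [List.length_append] at h₅
        omega
      · convert g₁ using 2
        · ext; simp; tauto
        · simp only [← Multiset.coe_add]; abel
    · exact ⟨_, _, .nonterminal (mem_lhs hr) hr (hu.erase hA) hw, g₁⟩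

/-- `G.IsFreeLoop X u v`: there is a small loop with parts `u` and `v` that is rooted in `X` and
uses only nonterminals of `X`. It can be inserted arbitrarily often into a parse tree with set of
nonterminals `X`, without changing that set. -/
def IsFreeLoop (G : ContextFreeGrammar T) (X : Finset G.NT) (u v : List T) : Prop :=
  ∃ A ∈ X, ∃ Z ⊆ X, G.Loop A u v Z ∧ u.length + v.length ≤ 2 ^ (2 * G.symb)

/-- The Parikh vector of a sequence of loops. -/
def loopSum (l : List (List T × List T)) : Multiset T :=
  (l.map fun x => ((x.1 ++ x.2 : List T) : Multiset T)).sum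

/-- Growth steps that enlarge the set of nonterminals are few, so they can be included in a small
base; the other ones are free loops. -/
theorem exists_base_of_grow {x y : Finset G.NT × Multiset T} (h : Relation.ReflTransGen G.Grow x y)
    {s : List (Symbol T G.NT)} {w : List T} (hw : G.Yields s w x.1) (hx : x.2 = w)
    (hn : w.length ≤ 2 ^ (2 * G.symb)) :
    ∃ w₀ : List T, G.Yields s w₀ y.1 ∧ w₀.length ≤ 2 ^ (2 * G.symb) * (1 + y.1.card) ∧
      ∃ l : List (List T × List T), (∀ p ∈ l, G.IsFreeLoop y.1 p.1 p.2) ∧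
        y.2 = w₀ + loopSum l := by
  classical
  induction h with
  | refl => exact ⟨w, hw, hn.trans (Nat.le_mul_of_pos_right _ (by omega)), [], by simp,
      by simp [hx, loopSum]⟩
  | @tail y z _ hz ih =>
    obtain ⟨w₀, h₁, h₂, l, h₃, h₄⟩ := ih
    obtain ⟨A, hA, u, v, Z, hl, hu, rfl⟩ := hz
    by_cases hZ : Z ⊆ y.1
    · have e : y.1 ∪ Z = y.1 := Finset.union_eq_left.2 hZ
      simp only [e]
      refine ⟨w₀, h₁, h₂, (u, v) :: l, ?_, ?_⟩
      · simp only [List.mem_cons, forall_eq_or_imp]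
        exact ⟨⟨A, hA, Z, hZ, hl, hu⟩, h₃⟩
      · simp only [h₄, loopSum, List.map_cons, List.sum_cons, ← Multiset.coe_add]; abel
    · obtain ⟨w', h₅, h₆, -⟩ := h₁.insert_loop hA hl
      have hlt : y.1.card < (y.1 ∪ Z).card := Finset.card_lt_card <|
        Finset.ssubset_iff_subset_ne.2 ⟨Finset.subset_union_left, fun h =>
          hZ (Finset.union_eq_left.1 h.symm)⟩
      refine ⟨w', h₅, ?_, l, fun p hp => ?_, ?_⟩
      · have := congrArg Multiset.card h₆
        simp only [Multiset.coe_card, Multiset.card_add] at this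
        calc w'.length ≤ 2 ^ (2 * G.symb) * (1 + (1 + y.1.card)) := by
              rw [Nat.mul_add _ 1]; omega
          _ ≤ _ := Nat.mul_le_mul_left _ (by simp only; omega)
      · obtain ⟨B, hB, Z', hZ', h⟩ := h₃ p hp
        exact ⟨B, Finset.mem_union_left _ hB, Z', hZ'.trans Finset.subset_union_left, h⟩
      · simp only [h₄, h₆]; abel

theorem Yields.exists_base {A : G.NT} {w : List T} {X : Finset G.NT}
    (h : G.Yields [.nonterminal A] w X) :
    ∃ w₀ : List T, G.Yields [.nonterminal A] w₀ X ∧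
      w₀.length ≤ 2 ^ (2 * G.symb) * (1 + X.card) ∧
      ∃ l : List (List T × List T), (∀ p ∈ l, G.IsFreeLoop X p.1 p.2) ∧
        (w : Multiset T) = w₀ + loopSum l := by
  obtain ⟨w₀, X₀, h₁, h₂⟩ := h.exists_grow
  refine exists_base_of_grow h₂ h₁.yields rfl ?_
  have := h₁.length_le
  rw [sum_weight, List.length_singleton, one_mul] at this
  exact this.trans (Nat.pow_le_pow_right two_pos (by omega))

theorem Yields.insert_free_loops {s : List (Symbol T G.NT)} {w : List T} {X : Finset G.NT}
    (h : G.Yields s w X) (l : List (List T × List T)) (hl : ∀ p ∈ l, G.IsFreeLoop X p.1 p.2) :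
    ∃ w', G.Yields s w' X ∧ (w' : Multiset T) = w + loopSum l := by
  classical
  induction l with
  | nil => exact ⟨w, h, by simp [loopSum]⟩
  | cons p l ih =>
    simp only [List.mem_cons, forall_eq_or_imp] at hl
    obtain ⟨w₁, h₁, h₂⟩ := ih hl.2
    obtain ⟨A, hA, Z, hZ, hp, -⟩ := hl.1
    obtain ⟨w₂, h₃, h₄, -⟩ := h₁.insert_loop hA hp
    refine ⟨w₂, h₃.congr rfl (Finset.union_eq_left.2 hZ), ?_⟩
    rw [h₄, h₂]
    simp only [loopSum, List.map_cons, List.sum_cons, ← Multiset.coe_add]; abel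

end ContextFreeGrammar

/-! ### Counting turns -/

namespace PDA

/-- The heights `H 0, …, H n` split into `l` consecutive one-turn pieces. -/
inductive Turns (H : ℕ → ℕ) : ℕ → ℕ → Prop
  | zero : Turns H 0 0
  | succ {l s e} : Turns H l s → IsOneTurn H s e → Turns H (l + 1) e

theorem IsOneTurn.congr {H H' : ℕ → ℕ} {s e : ℕ} (h : IsOneTurn H s e)
    (hH : ∀ i ≤ e, H i = H' i) : IsOneTurn H' s e := by
  obtain ⟨p, j, h₁, h₂, h₃, h₄, h₅, h₆, h₇⟩ := h
  refine ⟨p, j, h₁, h₂, h₃, fun a ha b hb hab => ?_, ?_, ?_, fun a ha b hb hab => ?_⟩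
  · rw [← hH a (ha.2.trans h₃.le), ← hH b (hb.2.trans h₃.le)]; exact h₄ ha hb hab
  · rwa [← hH p (by omega), ← hH (p + 1) (by omega)]
  · rwa [← hH j (by omega), ← hH (j + 1) (by omega)]
  · rw [← hH a ha.2, ← hH b hb.2]; exact h₇ ha hb hab

theorem IsOneTurn.lt {H : ℕ → ℕ} {s e : ℕ} (h : IsOneTurn H s e) : s < e := by
  obtain ⟨p, j, h₁, h₂, h₃, -⟩ := h
  omega

theorem Turns.congr {H H' : ℕ → ℕ} {l n : ℕ} (h : Turns H l n)
    (hH : ∀ i ≤ n, H i = H' i) : Turns H' l n := by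
  induction h with
  | zero => exact .zero
  | succ _ h ih => exact .succ (ih fun i hi => hH i (hi.trans h.lt.le)) (h.congr hH)

theorem antitoneOn_Icc_append {H : ℕ → ℕ} {j e e' : ℕ} (h : AntitoneOn H (Set.Icc j e))
    (h' : AntitoneOn H (Set.Icc e e')) : AntitoneOn H (Set.Icc j e') := by
  rcases lt_or_ge e j with hj | hj
  · exact h'.mono (Set.Icc_subset_Icc hj.le le_rfl)
  rintro a ⟨ha, ha'⟩ b ⟨hb, hb'⟩ hab
  rcases le_total b e with h₁ | h₁
  · exact h ⟨ha, hab.trans h₁⟩ ⟨hb, h₁⟩ hab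
  rcases le_total a e with h₂ | h₂
  · exact (h' ⟨le_rfl, h₁.trans hb'⟩ ⟨h₁, hb'⟩ h₁).trans (h ⟨ha, h₂⟩ ⟨hj, le_rfl⟩ h₂)
  · exact h' ⟨h₂, ha'⟩ ⟨h₁, hb'⟩ hab

theorem Turns.append {H : ℕ → ℕ} {l n n' : ℕ} (h : Turns H (l + 1) n) (hn : n ≤ n')
    (h' : AntitoneOn H (Set.Icc n n')) : Turns H (l + 1) n' := by
  cases h with
  | succ h₀ h =>
    obtain ⟨p, j, h₁, h₂, h₃, h₄, h₅, h₆, h₇⟩ := h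
    exact .succ h₀ ⟨p, j, h₁, h₂, h₃.trans_le hn, h₄, h₅, h₆, antitoneOn_Icc_append h₇ h'⟩

theorem Turns.exists_splitting {H : ℕ → ℕ} {l n : ℕ} (h : Turns H l n) :
    ∃ i : ℕ → ℕ, i 0 = 0 ∧ i l = n ∧ ∀ j < l, IsOneTurn H (i j) (i (j + 1)) := by
  induction h with
  | zero => exact ⟨fun _ => 0, rfl, rfl, by simp⟩
  | @succ l s e _ h ih =>
    obtain ⟨i, h₀, rfl, h₁⟩ := ih
    refine ⟨fun j => if j ≤ l then i j else e, by simp [h₀], by simp, fun j hj => ?_⟩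
    rcases Nat.lt_succ_iff_lt_or_eq.1 hj with hj | rfl
    · simpa [hj.le, Nat.succ_le_of_lt hj] using h₁ j hj
    · simpa using h

theorem monotoneOn_Icc_succ {H : ℕ → ℕ} {t n : ℕ} (h : MonotoneOn H (Set.Icc t n))
    (hn : H n ≤ H (n + 1)) : MonotoneOn H (Set.Icc t (n + 1)) := by
  rintro a ⟨ha, ha'⟩ b ⟨hb, hb'⟩ hab
  rcases Nat.lt_succ_iff_lt_or_eq.1 (Nat.lt_succ_of_le hb') with hb' | rfl
  · exact h ⟨ha, hab.trans (by omega)⟩ ⟨hb, by omega⟩ hab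
  · rcases Nat.lt_succ_iff_lt_or_eq.1 (Nat.lt_succ_of_le ha') with ha' | rfl
    · exact (h ⟨ha, by omega⟩ ⟨by omega, le_rfl⟩ (by omega)).trans hn
    · exact le_rfl

theorem antitoneOn_Icc_succ {H : ℕ → ℕ} {n : ℕ} (hn : H (n + 1) ≤ H n) :
    AntitoneOn H (Set.Icc n (n + 1)) := by
  rintro a ⟨ha, ha'⟩ b ⟨hb, hb'⟩ hab
  obtain rfl | rfl : a = n ∨ a = n + 1 := by omega
  · obtain rfl | rfl : b = a ∨ b = a + 1 := by omega
    exacts [le_rfl, hn]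
  · obtain rfl : b = n + 1 := by omega
    exact le_rfl

/-- The shape of the heights `H 0, …, H n` after `k` phases, in which they rise (even phases) and
fall (odd phases) alternately: one-turn pieces, at most one for each pair of a rising and a falling
phase, followed by a non-decreasing rest. -/
def Shape (k n : ℕ) (H : ℕ → ℕ) : Prop :=
  (∃ l ≤ k / 2, ∃ t ≤ n, Turns H l t ∧ MonotoneOn H (Set.Icc t n)) ∨
    (¬ Even k ∧ ∃ l ≤ k / 2, Turns H (l + 1) n)

theorem Shape.congr {H H' : ℕ → ℕ} {k n : ℕ} (h : Shape k n H) (hH : ∀ i ≤ n, H i = H' i) :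
    Shape k n H' := by
  rcases h with ⟨l, hl, t, ht, h₁, h₂⟩ | ⟨hk, l, hl, h₁⟩
  · refine .inl ⟨l, hl, t, ht, h₁.congr fun i hi => hH i (hi.trans ht), fun a ha b hb hab => ?_⟩
    rw [← hH a ha.2, ← hH b hb.2]
    exact h₂ ha hb hab
  · exact .inr ⟨hk, l, hl, h₁.congr hH⟩

theorem Shape.next {H : ℕ → ℕ} {k n : ℕ} (h : Shape k n H) : Shape (k + 1) n H := by
  rcases h with ⟨l, hl, h⟩ | ⟨hk, l, hl, h⟩
  · exact .inl ⟨l, by omega, h⟩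
  · rw [Nat.not_even_iff] at hk
    refine .inl ⟨l + 1, by omega, n, le_rfl, h, ?_⟩
    simp

theorem Shape.step {H : ℕ → ℕ} {k n : ℕ} (h : Shape k n H) (hup : Even k → H n ≤ H (n + 1))
    (hdown : ¬ Even k → H (n + 1) ≤ H n) (hmin : H 0 ≤ H (n + 1)) : Shape k (n + 1) H := by
  by_cases hk : Even k
  · rcases h with ⟨l, hl, t, ht, h₁, h₂⟩ | ⟨hk', -⟩
    · exact .inl ⟨l, hl, t, by omega, h₁, monotoneOn_Icc_succ h₂ (hup hk)⟩
    · exact absurd hk hk'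
  · have hd := antitoneOn_Icc_succ (hdown hk)
    rcases h with ⟨l, hl, t, ht, h₁, h₂⟩ | ⟨-, l, hl, h₁⟩
    · rcases (hdown hk).eq_or_lt with he | hlt
      · exact .inl ⟨l, hl, t, by omega, h₁, monotoneOn_Icc_succ h₂ he.ge⟩
      · by_cases hr : ∃ p, t ≤ p ∧ p < n ∧ H p < H (p + 1)
        · obtain ⟨p, hp, hp', hlt'⟩ := hr
          exact .inr ⟨hk, l, hl, h₁.succ ⟨p, n, hp, hp', n.lt_succ_self, h₂, hlt', hlt, hd⟩⟩
        · -- the rest is constant, so that the fall prolongs the last turn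
          push Not at hr
          have hc : AntitoneOn H (Set.Icc t n) := by
            refine antitoneOn_of_succ_le Set.ordConnected_Icc fun a _ ha ha' => ?_
            rw [Nat.succ_eq_succ] at ha' ⊢
            exact hr a ha.1 (Nat.lt_of_succ_le ha'.2)
          cases l with
          | succ l =>
            exact .inr ⟨hk, l, by omega, h₁.append (by omega) (antitoneOn_Icc_append hc hd)⟩
          | zero =>
            cases h₁
            have := h₂ ⟨le_rfl, ht⟩ ⟨ht, le_rfl⟩ ht
            have := hc ⟨le_rfl, ht⟩ ⟨ht, le_rfl⟩ ht
            omega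
    · exact .inr ⟨hk, l, hl, h₁.append (by omega) hd⟩

theorem Shape.isKTurnSeq {H : ℕ → ℕ} {k n : ℕ} (h : Shape (2 * k) n H)
    (hmin : ∀ i ≤ n, H n ≤ H i) : IsKTurnSeq k H n := by
  rcases h with ⟨l, hl, t, ht, h₁, h₂⟩ | ⟨hk, -⟩
  · have hc : ∀ a ∈ Set.Icc t n, H a = H n := fun a ha =>
      le_antisymm (h₂ ha ⟨ht, le_rfl⟩ ha.2) (hmin a ha.2)
    cases l with
    | zero =>
      cases h₁
      left
      intro p q hpq hq hlt
      have := hc p ⟨by omega, by omega⟩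
      have := hc (p + 1) ⟨by omega, by omega⟩
      omega
    | succ l =>
      refine .inr ⟨l + 1, by omega, (h₁.append ht fun a ha b hb _ => ?_).exists_splitting⟩
      rw [hc a ha, hc b hb]
  · exact absurd (even_two_mul k) hk

/-- `Phased r h c₀ k c`: there is an `r`-path from `c₀` to `c`, divided into the phases `0, …, k`,
along which the height `h` does not decrease in even phases, does not increase in odd phases and
never falls below its initial value. Phases may be empty. -/
inductive Phased {X : Type*} (r : X → X → Prop) (h : X → ℕ) (c₀ : X) : ℕ → X → Prop
  | start : Phased r h c₀ 0 c₀
  | step {k c c'} : Phased r h c₀ k c → r c c' → (Even k → h c ≤ h c') →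
      (¬ Even k → h c' ≤ h c) → h c₀ ≤ h c' → Phased r h c₀ k c'
  | next {k c} : Phased r h c₀ k c → Phased r h c₀ (k + 1) c

theorem Phased.exists_shape {X : Type*} {r : X → X → Prop} {h : X → ℕ} {c₀ c : X} {k : ℕ}
    (hc : Phased r h c₀ k c) : ∃ (n : ℕ) (f : ℕ → X), f 0 = c₀ ∧ (∀ i < n, r (f i) (f (i + 1))) ∧
      f n = c ∧ (∀ i ≤ n, h c₀ ≤ h (f i)) ∧ Shape k n fun i => h (f i) := by
  induction hc with
  | start =>
    refine ⟨0, fun _ => c₀, rfl, by simp, rfl, by simp, .inl ⟨0, le_rfl, 0, le_rfl, .zero, ?_⟩⟩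
    simp
  | @step k c c' _ hr hup hdown hmin ih =>
    obtain ⟨n, f, h₀, h₁, rfl, h₂, h₃⟩ := ih
    refine ⟨n + 1, fun i => if i ≤ n then f i else c', by simp [h₀], fun i hi => ?_, by simp,
      fun i hi => ?_, ?_⟩
    · rcases Nat.lt_succ_iff_lt_or_eq.1 hi with hi | rfl
      · simpa [hi.le, Nat.succ_le_of_lt hi] using h₁ i hi
      · simpa using hr
    · simp only
      split_ifs with h
      exacts [h₂ i h, hmin]
    · refine (h₃.congr fun i hi => by simp [hi]).step ?_ ?_ ?_
      · simpa using hup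
      · simpa using hdown
      · simpa [h₀] using hmin
  | next _ ih =>
    obtain ⟨n, f, h₀, h₁, h₂, h₃, h₄⟩ := ih
    exact ⟨n, f, h₀, h₁, h₂, h₃, h₄.next⟩

theorem Phased.reflTransGen {X : Type*} {r : X → X → Prop} {h : X → ℕ} {c₀ c : X} {k : ℕ}
    (hc : Phased r h c₀ k c) : Relation.ReflTransGen r c₀ c := by
  induction hc with
  | start => exact .refl
  | step _ hr _ _ _ ih => exact ih.tail hr
  | next _ ih => exact ih

theorem Phased.isKTurnSeq {X : Type*} {r : X → X → Prop} {h : X → ℕ} {c₀ c : X} {k : ℕ}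
    (hc : Phased r h c₀ (2 * k) c) (he : h c = h c₀) :
    ∃ (n : ℕ) (f : ℕ → X), f 0 = c₀ ∧ (∀ i < n, r (f i) (f (i + 1))) ∧ f n = c ∧
      IsKTurnSeq k (fun i => h (f i)) n := by
  obtain ⟨n, f, h₀, h₁, rfl, h₂, h₃⟩ := hc.exists_shape
  exact ⟨n, f, h₀, h₁, rfl, h₃.isKTurnSeq fun i hi => he.trans_le (h₂ i hi)⟩

end PDA

/-! ### Pushdown automata given by moves -/

namespace PDA

/-- The possible actions of a pushdown automaton in normal form. The stack symbols above the bottom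
symbol are Booleans. -/
inductive Act (α : Type*)
  | read (a : α)
  | nop
  | push (s : Bool)
  | pop (s : Bool)

variable {α Q : Type*}

/-- The pushdown automaton with moves `R`. Its bottom symbol is `none`. -/
def ofMoves [Finite Q] (R : Q → Act α → Q → Prop) (q₀ : Q) (F : Set Q) : PDA α Q (Option Bool) where
  δ q a Z := {x | (∃ t, a = some t ∧ R q (.read t) x.1 ∧ x.2 = [Z]) ∨
    (a = none ∧ R q .nop x.1 ∧ x.2 = [Z]) ∨
    (a = none ∧ ∃ s, R q (.push s) x.1 ∧ x.2 = [some s, Z]) ∨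
    (a = none ∧ ∃ s, Z = some s ∧ R q (.pop s) x.1 ∧ x.2 = [])}
  finite_δ q a Z := by
    refine ((Set.toFinite (Set.univ : Set Q)).prod (Set.toFinite
      {[Z], [some true, Z], [some false, Z], []})).subset ?_
    rintro ⟨p, β⟩ h
    refine ⟨Set.mem_univ _, ?_⟩
    rcases h with ⟨t, -, -, h⟩ | ⟨-, -, h⟩ | ⟨-, s, -, h⟩ | ⟨-, s, -, -, h⟩
    · simp_all
    · simp_all
    · cases s <;> simp_all
    · simp_all
  q₀ := q₀
  Z₀ := none
  F := F

/-- The configuration with state `q`, unread input `w` and the symbols `st` above the bottom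
symbol. -/
def conf (q : Q) (w : List α) (st : List Bool) : Config α Q (Option Bool) :=
  ⟨q, w, st.map some ++ [none]⟩

variable [Finite Q] {R : Q → Act α → Q → Prop} {q₀ : Q} {F : Set Q}

theorem step_read {q q' : Q} {a : α} (w : List α) (st : List Bool) (h : R q (.read a) q') :
    (ofMoves R q₀ F).Step (conf q (a :: w) st) (conf q' w st) := by
  obtain ⟨Z, γ, hZ⟩ : ∃ Z γ, st.map some ++ [none] = Z :: γ := by
    cases st <;> exact ⟨_, _, rfl⟩
  exact ⟨some a, Z, [Z], γ, .inl ⟨a, rfl, h, rfl⟩, rfl, hZ, hZ⟩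

theorem step_nop {q q' : Q} (w : List α) (st : List Bool) (h : R q .nop q') :
    (ofMoves R q₀ F).Step (conf q w st) (conf q' w st) := by
  obtain ⟨Z, γ, hZ⟩ : ∃ Z γ, st.map some ++ [none] = Z :: γ := by
    cases st <;> exact ⟨_, _, rfl⟩
  exact ⟨none, Z, [Z], γ, .inr (.inl ⟨rfl, h, rfl⟩), rfl, hZ, hZ⟩

theorem step_push {q q' : Q} {s : Bool} (w : List α) (st : List Bool) (h : R q (.push s) q') :
    (ofMoves R q₀ F).Step (conf q w st) (conf q' w (s :: st)) := by
  obtain ⟨Z, γ, hZ⟩ : ∃ Z γ, st.map some ++ [none] = Z :: γ := by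
    cases st <;> exact ⟨_, _, rfl⟩
  exact ⟨none, Z, [some s, Z], γ, .inr (.inr (.inl ⟨rfl, s, h, rfl⟩)), rfl, hZ, by
    simp [conf, hZ]⟩

theorem step_pop {q q' : Q} {s : Bool} (w : List α) (st : List Bool) (h : R q (.pop s) q') :
    (ofMoves R q₀ F).Step (conf q w (s :: st)) (conf q' w st) :=
  ⟨none, some s, [], st.map some ++ [none], .inr (.inr (.inr ⟨rfl, s, rfl, h, rfl⟩)), rfl, rfl, rfl⟩

/-- A predicate that holds initially and is preserved by the moves holds at all reachable
configurations. -/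
theorem ofMoves_invariant {P : Q → List α → List Bool → Prop} {w : List α}
    (init : P q₀ w [])
    (read : ∀ q q' a w st, R q (.read a) q' → P q (a :: w) st → P q' w st)
    (nop : ∀ q q' w st, R q .nop q' → P q w st → P q' w st)
    (push : ∀ q q' s w st, R q (.push s) q' → P q w st → P q' w (s :: st))
    (pop : ∀ q q' s w st, R q (.pop s) q' → P q w (s :: st) → P q' w st)
    {c : Config α Q (Option Bool)}
    (h : Relation.ReflTransGen (ofMoves R q₀ F).Step ((ofMoves R q₀ F).init w) c) :
    ∃ q w' st, c = conf q w' st ∧ P q w' st := by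
  induction h with
  | refl => exact ⟨q₀, w, [], rfl, init⟩
  | @tail c c' _ h ih =>
    obtain ⟨q, u, st, rfl, hP⟩ := ih
    obtain ⟨p, v, S⟩ := c'
    obtain ⟨a, Z, β, γ, h, hu, hS, rfl⟩ := h
    simp only [conf] at h hu hS
    subst hu
    rcases h with ⟨t, rfl, h, rfl⟩ | ⟨rfl, h, rfl⟩ | ⟨rfl, s, h, rfl⟩ | ⟨rfl, s, rfl, h, rfl⟩
    · refine ⟨p, v, st, ?_, read _ _ t _ _ h hP⟩
      simp only [conf, hS, List.cons_append, List.nil_append]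
    · refine ⟨p, v, st, ?_, nop _ _ _ _ h hP⟩
      simp only [conf, hS, List.cons_append, List.nil_append]
    · refine ⟨p, v, s :: st, ?_, push _ _ _ _ _ h hP⟩
      simp only [conf, hS, List.map_cons, List.cons_append, List.nil_append]
    · cases st with
      | nil => simp at hS
      | cons s' st =>
        simp only [List.map_cons, List.cons_append, List.cons.injEq, Option.some.injEq] at hS
        obtain ⟨rfl, rfl⟩ := hS
        exact ⟨p, v, st, rfl, pop _ _ _ _ _ h hP⟩

theorem ofMoves_isNormalForm
    (h : ∀ w q st, Relation.ReflTransGen (ofMoves R q₀ F).Step ((ofMoves R q₀ F).init w)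
      (conf q [] st) → q ∈ F → st = []) : (ofMoves R q₀ F).IsNormalForm where
  accept_stack w c hc hacc := by
    obtain ⟨q, w', st, rfl, -⟩ := ofMoves_invariant (P := fun _ _ _ => True) trivial
      (by simp) (by simp) (by simp) (by simp) hc
    obtain ⟨hF, hw⟩ := hacc
    obtain rfl : w' = [] := hw
    rw [h w q st hc hF]
    rfl
  read q p a Z β hβ := by
    rcases hβ with ⟨t, -, -, h⟩ | ⟨h, -⟩ | ⟨h, -⟩ | ⟨h, -⟩
    · exact h
    all_goals simp at h
  eps q p Z β hβ := by
    rcases hβ with ⟨t, h, -⟩ | ⟨-, -, h⟩ | ⟨-, s, -, h⟩ | ⟨-, s, h, -, h'⟩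
    · simp at h
    · exact .inl h
    · exact .inr (.inr ⟨some s, by simp [ofMoves], h⟩)
    · exact .inr (.inl ⟨h', by simp [ofMoves, h]⟩)

/-! ### An automaton for sums of paired vectors -/

/-- The vector with `p` letters `fst` and `q` letters `snd`. -/
structure Item (m : ℕ) where
  fst : Fin m
  snd : Fin m
  p : ℕ
  q : ℕ

/-- The vector described by an item. -/
def Item.vec {m : ℕ} (x : Item m) : Multiset (Fin m) :=
  Multiset.replicate x.p x.fst + Multiset.replicate x.q x.snd

/-- The part of an item that goes through the stack. -/
def Item.pushed {m : ℕ} (x : Item m) : Multiset (Fin m) := Multiset.replicate x.q x.snd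

/-- A family of sets of vectors over the letters `Fin m`, each consisting of the sums of a base
vector and arbitrarily many vectors from a menu. All entries are bounded by `B`. An item with `q =
0` involves a single letter; the pairs of letters of the other items in a menu do not cross. -/
structure VectorFamily (m B : ℕ) (I : Type) where
  base : I → Multiset (Fin m)
  menu : I → Set (Item m)
  base_le : ∀ ι k, (base ι).count k ≤ B
  p_le : ∀ ι, ∀ x ∈ menu ι, x.p ≤ B
  q_le : ∀ ι, ∀ x ∈ menu ι, x.q ≤ B
  fst_lt_snd : ∀ ι, ∀ x ∈ menu ι, 0 < x.q → x.fst < x.snd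
  not_cross : ∀ ι, ∀ x ∈ menu ι, ∀ y ∈ menu ι, 0 < x.q → 0 < y.q →
    x.fst < y.fst → y.fst < x.snd → y.snd ≤ x.snd

namespace VectorFamily

variable {m B : ℕ} {I : Type} (D : VectorFamily m B I)

/-- The sorted words whose Parikh vector belongs to the family. -/
def language : Language (Fin m) :=
  {w | w.Pairwise (· ≤ ·) ∧ ∃ ι, ∃ l : List (Item m), (∀ x ∈ l, x ∈ D.menu ι) ∧
    (w : Multiset (Fin m)) = D.base ι + (l.map Item.vec).sum}

/-- The states of the automaton, apart from an initial one: the chosen member `ι` of the family,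
the letter `i` that is being read, the target letter `j` of the current item, the set of the
targets that occur on the stack, the number `p` of letters `i` still to be read and the number `q`
of symbols for the target `j` still to be pushed. -/
abbrev Ctrl (m B : ℕ) (I : Type) : Type :=
  I × Fin m × Fin m × Finset (Fin m) × Fin (B + 1) × Fin (B + 1)

/-- The moves of the automaton. The stack holds one symbol for each letter that is due later, the
earliest ones on top; the symbol is `true` if no symbol with the same target lies below it. -/
inductive Move : Option (Ctrl m B I) → Act (Fin m) → Option (Ctrl m B I) → Prop
  | init {ι i j p q} : i.val = 0 → p.val = (D.base ι).count i → q.val = 0 →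
      Move none .nop (some (ι, i, j, ∅, p, q))
  | read {ι i j R p p' q} : p'.val + 1 = p.val →
      Move (some (ι, i, j, R, p, q)) (.read i) (some (ι, i, j, R, p', q))
  | push {ι i j R p q q'} : p.val = 0 → q'.val + 1 = q.val → (∀ k ∈ R, j ≤ k) →
      Move (some (ι, i, j, R, p, q)) (.push (decide (j ∉ R))) (some (ι, i, j, insert j R, p, q'))
  | item {ι i j j' R p p' q q'} {x : Item m} : p.val = 0 → q.val = 0 → x ∈ D.menu ι →
      x.fst = i → x.snd = j' → x.p = p'.val → x.q = q'.val →
      Move (some (ι, i, j, R, p, q)) .nop (some (ι, i, j', R, p', q'))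
  | pop {ι i j R p p' q} {s : Bool} : p.val = 0 → q.val = 0 → (∀ k ∈ R, i ≤ k) → i ∈ R →
      p'.val = 1 →
      Move (some (ι, i, j, R, p, q)) (.pop s) (some (ι, i, j, if s then R.erase i else R, p', q))
  | next {ι i i' j R p p' q} : p.val = 0 → q.val = 0 → i ∉ R → i'.val = i.val + 1 →
      p'.val = (D.base ι).count i' →
      Move (some (ι, i, j, R, p, q)) .nop (some (ι, i', j, R, p', q))

/-- The final states: nothing is left to be done, and the last letter has been reached. -/
def final (m B : ℕ) (I : Type) : Set (Option (Ctrl m B I)) :=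
  {s | ∃ ι i j p q, s = some (ι, i, j, ∅, p, q) ∧ i.val + 1 = m ∧ p.val = 0 ∧ q.val = 0}

/-- The automaton of the family. -/
def pda [Finite I] : PDA (Fin m) (Option (Ctrl m B I)) (Option Bool) :=
  ofMoves D.Move none (final m B I)

/-- The stack for the list `ts` of targets. -/
def encode {m : ℕ} : List (Fin m) → List Bool
  | [] => []
  | t :: ts => decide (t ∉ ts) :: encode ts

/-- The invariant of the computations on the word `w`: apart from what is on the stack or yet to be
read or pushed, the letters read so far account for the base up to the current letter and for some
items of the menu. -/
def Inv (w : List (Fin m)) : Option (Ctrl m B I) → List (Fin m) → List Bool → Prop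
  | none, v, st => v = w ∧ st = []
  | some (ι, i, j, R, p, q), v, st => ∃ (u ts : List (Fin m)) (l : List (Item m)), w = u ++ v ∧
      u.Pairwise (· ≤ ·) ∧ (∀ x ∈ u, x ≤ i) ∧ ts.Pairwise (· ≤ ·) ∧ ts.toFinset = R ∧
      st = encode ts ∧ (∀ x ∈ l, x ∈ D.menu ι) ∧
      (u : Multiset (Fin m)) + ts + Multiset.replicate p i + Multiset.replicate q j =
        (D.base ι).filter (· ≤ i) + (l.map Item.vec).sum

theorem filter_le_zero (s : Multiset (Fin m)) {i : Fin m} (hi : i.val = 0) :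
    s.filter (· ≤ i) = Multiset.replicate (s.count i) i := by
  rw [← Multiset.filter_eq']
  refine Multiset.filter_congr fun x _ => ?_
  rw [Fin.le_def, Fin.ext_iff]; omega

theorem filter_le_succ (s : Multiset (Fin m)) {i i' : Fin m} (hi : i'.val = i.val + 1) :
    s.filter (· ≤ i') = s.filter (· ≤ i) + Multiset.replicate (s.count i') i' := by
  rw [← Multiset.filter_eq', Multiset.filter_add_filter]
  have h₁ : Multiset.filter (fun a => a ≤ i ∨ a = i') s = Multiset.filter (· ≤ i') s :=
    Multiset.filter_congr fun x _ => by rw [Fin.le_def, Fin.le_def, Fin.ext_iff]; omega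
  have h₂ : Multiset.filter (fun a => a ≤ i ∧ a = i') s = 0 :=
    Multiset.filter_eq_nil.2 fun x _ => by rw [Fin.le_def, Fin.ext_iff]; omega
  rw [h₁, h₂, add_zero]

variable {D}

theorem Inv.of_move {w : List (Fin m)} {s s' : Option (Ctrl m B I)} {v v' : List (Fin m)}
    {st st' : List Bool} {a : Act (Fin m)} (h : D.Move s a s') (hs : D.Inv w s v st)
    (ha : match a with
      | .read t => v = t :: v' ∧ st' = st
      | .nop => v = v' ∧ st' = st
      | .push b => v = v' ∧ st' = b :: st
      | .pop b => v = v' ∧ st = b :: st') : D.Inv w s' v' st' := by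
  cases h with
  | @init ι i j p q hi hp hq =>
    obtain ⟨rfl, rfl⟩ := ha
    obtain ⟨rfl, rfl⟩ := hs
    refine ⟨[], [], [], rfl, .nil, by simp, .nil, rfl, rfl, by simp, ?_⟩
    simp [filter_le_zero _ hi, hp, hq]
  | @read ι i j R p p' q hp =>
    obtain ⟨rfl, rfl⟩ := ha
    obtain ⟨u, ts, l, rfl, hu, hui, hts, hR, hst, hl, he⟩ := hs
    refine ⟨u ++ [i], ts, l, by simp, ?_, ?_, hts, hR, hst, hl, ?_⟩
    · exact List.pairwise_append.2 ⟨hu, by simp, by simpa using hui⟩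
    · simpa [or_imp, forall_and] using hui
    · rw [← he, ← hp, Multiset.replicate_succ, ← Multiset.singleton_add, ← Multiset.coe_add,
        Multiset.coe_singleton]
      abel
  | @push ι i j R p q q' hp hq hj =>
    obtain ⟨rfl, rfl⟩ := ha
    obtain ⟨u, ts, l, rfl, hu, hui, hts, rfl, rfl, hl, he⟩ := hs
    refine ⟨u, j :: ts, l, rfl, hu, hui, ?_, by simp, ?_, hl, ?_⟩
    · exact List.pairwise_cons.2 ⟨by simpa using hj, hts⟩
    · simp [encode]
    · rw [← he, ← hq, Multiset.replicate_succ, ← Multiset.singleton_add, ← Multiset.cons_coe,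
        ← Multiset.singleton_add]
      abel
  | @item ι i j j' R p p' q q' x hp hq hx h₁ h₂ h₃ h₄ =>
    obtain ⟨rfl, rfl⟩ := ha
    obtain ⟨u, ts, l, rfl, hu, hui, hts, hR, hst, hl, he⟩ := hs
    refine ⟨u, ts, x :: l, rfl, hu, hui, hts, hR, hst, by simpa using ⟨hx, hl⟩, ?_⟩
    simp only [hp, hq, Multiset.replicate_zero, add_zero] at he
    simp only [he, List.map_cons, List.sum_cons, Item.vec, h₁, h₂, h₃, h₄]
    abel
  | @pop ι i j R p p' q b hp hq hR hiR hp' =>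
    obtain ⟨rfl, rfl⟩ := ha
    obtain ⟨u, ts, l, rfl, hu, hui, hts, rfl, hst, hl, he⟩ := hs
    simp only [List.mem_toFinset] at hR hiR
    cases ts with
    | nil => simp at hiR
    | cons t ts =>
      simp only [encode, List.cons.injEq] at hst
      obtain ⟨rfl, rfl⟩ := hst
      rw [List.pairwise_cons] at hts
      -- the target on top is the smallest one
      obtain rfl : t = i := by
        refine le_antisymm ?_ (hR t (by simp))
        rcases List.mem_cons.1 hiR with rfl | h
        exacts [le_rfl, hts.1 i h]
      refine ⟨u, ts, l, rfl, hu, hui, hts.2, ?_, rfl, hl, ?_⟩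
      · by_cases h : t ∈ ts
        · simp [h]
        · simp [h]
      · rw [← he, hp', hp, ← Multiset.cons_coe, ← Multiset.singleton_add]
        simp only [Multiset.replicate_zero, Multiset.replicate_one]
        abel
  | @next ι i i' j R p p' q hp hq hi hi' hp' =>
    obtain ⟨rfl, rfl⟩ := ha
    obtain ⟨u, ts, l, rfl, hu, hui, hts, hR, hst, hl, he⟩ := hs
    refine ⟨u, ts, l, rfl, hu, fun x hx => (hui x hx).trans ?_, hts, hR, hst, hl, ?_⟩
    · rw [Fin.le_def]; omega
    · simp only [hp, Multiset.replicate_zero, add_zero] at he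
      rw [filter_le_succ _ hi', hp', add_right_comm (Multiset.filter _ _), ← he]
      abel

variable (D)

theorem exists_inv [Finite I] {w : List (Fin m)}
    {c : Config (Fin m) (Option (Ctrl m B I)) (Option Bool)}
    (h : Relation.ReflTransGen D.pda.Step (D.pda.init w) c) :
    ∃ s v st, c = conf s v st ∧ D.Inv w s v st :=
  ofMoves_invariant ⟨rfl, rfl⟩ (fun _ _ _ _ _ h h' => h'.of_move h ⟨rfl, rfl⟩)
    (fun _ _ _ _ h h' => h'.of_move h ⟨rfl, rfl⟩) (fun _ _ _ _ _ h h' => h'.of_move h ⟨rfl, rfl⟩)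
    (fun _ _ _ _ _ h h' => h'.of_move h ⟨rfl, rfl⟩) h

theorem conf_injective {q q' : Option (Ctrl m B I)} {w w' : List (Fin m)} {st st' : List Bool}
    (h : conf q w st = conf q' w' st') : q = q' ∧ w = w' ∧ st = st' := by
  simp only [conf, Config.mk.injEq, List.append_cancel_right_eq] at h
  exact ⟨h.1, h.2.1, List.map_injective_iff.2 (Option.some_injective _) h.2.2⟩

theorem pda_isNormalForm [Finite I] : D.pda.IsNormalForm := by
  refine ofMoves_isNormalForm fun w q st h hq => ?_
  obtain ⟨s, v, st', h₁, h₂⟩ := D.exists_inv h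
  obtain ⟨rfl, rfl, rfl⟩ := conf_injective h₁
  obtain ⟨ι, i, j, p, q', rfl, -⟩ := hq
  obtain ⟨u, ts, l, -, -, -, -, hR, rfl, -⟩ := h₂
  rw [List.toFinset_eq_empty_iff] at hR
  rw [hR]; rfl

theorem accepts_pda_le [Finite I] : D.pda.accepts ≤ D.language := by
  rintro w ⟨c, h, hF, hw⟩
  obtain ⟨s, v, st, rfl, hs⟩ := D.exists_inv h
  obtain rfl : v = [] := hw
  obtain ⟨ι, i, j, p, q, rfl, hi, hp, hq⟩ : s ∈ final m B I := hF
  obtain ⟨u, ts, l, rfl, hu, -, -, hR, -, hl, he⟩ := hs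
  rw [List.toFinset_eq_empty_iff] at hR
  rw [List.append_nil]
  refine ⟨hu, ι, l, hl, ?_⟩
  have hb : (D.base ι).filter (· ≤ i) = D.base ι :=
    Multiset.filter_eq_self.2 fun x _ => by rw [Fin.le_def]; omega
  simpa [hR, hp, hq, hb] using he

end VectorFamily

end PDA

/-! ### Accepting computations with few turns -/

namespace PDA

namespace VectorFamily

variable {m B : ℕ} {I : Type} (D : VectorFamily m B I)

theorem mem_list_sum {α β : Type*} {l : List β} {f : β → Multiset α} {a : α} :
    a ∈ (l.map f).sum ↔ ∃ x ∈ l, a ∈ f x := by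
  induction l with
  | nil => simp
  | cons x l ih => simp [ih]

/-- What the items whose first letter is less than `i` put on the stack. -/
def due {m : ℕ} (l : List (Item m)) (i : ℕ) : Multiset (Fin m) :=
  ((l.filter fun x => x.fst.val < i).map Item.pushed).sum

theorem due_succ (l : List (Item m)) (i : Fin m) : due l (i + 1) =
    due l i + ((l.filter fun x => x.fst = i).map Item.pushed).sum := by
  induction l with
  | nil => rfl
  | cons x l ih =>
    simp only [due, List.filter_cons] at ih ⊢
    rcases lt_trichotomy x.fst i with h | h | h
    · have h₁ : x.fst.val < i.val := h
      have h₂ : x.fst.val < i.val + 1 := by omega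
      simp only [h₁, h₂, h.ne, decide_true, decide_false, if_true, List.map_cons,
        List.sum_cons, ih, Bool.false_eq_true, if_false]
      abel
    · have h₁ : ¬ x.fst.val < i.val := by rw [h]; omega
      have h₂ : x.fst.val < i.val + 1 := by rw [h]; omega
      simp only [h₁, h₂, decide_true, decide_false, if_true, List.map_cons,
        List.sum_cons, ih, Bool.false_eq_true, if_false]
      simp only [h, decide_true, if_true, List.map_cons, List.sum_cons]
      abel
    · have h₀ : i.val < x.fst.val := h
      have h₁ : ¬ x.fst.val < i.val := by omega
      have h₂ : ¬ x.fst.val < i.val + 1 := by omega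
      simp only [h₁, h₂, h.ne', decide_false, ih, Bool.false_eq_true, if_false]

theorem count_sum_vec {l : List (Item m)} (hl : ∀ x ∈ l, 0 < x.q → x.fst < x.snd) (i : Fin m) :
    (l.map Item.vec).sum.count i =
      (due l i).count i + ((l.filter fun x => x.fst = i).map Item.p).sum := by
  induction l with
  | nil => rfl
  | cons x l ih =>
    simp only [List.mem_cons, forall_eq_or_imp] at hl
    replace ih := ih hl.2
    simp only [due, List.filter_cons] at ih ⊢
    have hx : x.snd = i → ¬ x.fst < i → x.q = 0 := fun h h' => by
      by_contra hq
      exact h' (h ▸ hl.1 (Nat.pos_of_ne_zero hq))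
    simp only [List.map_cons, List.sum_cons, Multiset.count_add, ih, Item.vec,
      Multiset.count_replicate]
    rcases lt_trichotomy x.fst i with h | h | h
    · have h₁ : x.fst.val < i.val := h
      simp only [h₁, h.ne, decide_true, decide_false, if_true, List.map_cons,
        List.sum_cons, Bool.false_eq_true, if_false, Multiset.count_add, Item.pushed,
        Multiset.count_replicate]
      omega
    · have h₁ : ¬ x.fst.val < i.val := by rw [h]; omega
      have h₂ : ¬ x.fst < i := h₁
      simp only [h₁, decide_false, Bool.false_eq_true, if_false]
      simp only [h, decide_true, if_true, List.map_cons, List.sum_cons]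
      split_ifs with h₃
      · have := hx h₃ h₂; omega
      · omega
    · have h₀ : i.val < x.fst.val := h
      have h₁ : ¬ x.fst.val < i.val := by omega
      have h₂ : ¬ x.fst < i := h₁
      simp only [h₁, h.ne', decide_false, Bool.false_eq_true, if_false]
      split_ifs with h₃
      · have := hx h₃ h₂; omega
      · omega

theorem filter_le_eq_replicate_append {w : List (Fin m)} (h : w.Pairwise (· ≤ ·)) (i : Fin m) :
    w.filter (i ≤ ·) = List.replicate (w.count i) i ++ w.filter (i < ·) := by
  induction w with
  | nil => rfl
  | cons a w ih =>
    rw [List.pairwise_cons] at h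
    rcases lt_trichotomy a i with ha | rfl | ha
    · simp [ha.not_ge, ha.not_gt, ha.ne, ih h.2]
    · simp [ih h.2, List.replicate_succ]
    · have hw : ∀ x ∈ w, i < x := fun x hx => ha.trans_le (h.1 x hx)
      have h₁ : w.count i = 0 := List.count_eq_zero.2 fun hi => (hw i hi).false
      simp [ha.le, ha, ha.ne', ih h.2, h₁]

variable [Finite I]

/-- Configurations that are reached from the initial one with input `w` in `k` phases. -/
abbrev Reaches (w : List (Fin m)) (k : ℕ)
    (c : Config (Fin m) (Option (Ctrl m B I)) (Option Bool)) : Prop :=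
  Phased D.pda.Step (fun c => c.stack.length) (D.pda.init w) k c

variable {D} {w v v' : List (Fin m)} {k : ℕ} {s s' : Option (Ctrl m B I)} {st : List Bool}
  {ι : I} {i j : Fin m}

theorem length_init_le : (D.pda.init w).stack.length ≤ (conf s v st).stack.length := by
  simp [init, conf]

theorem Reaches.flat (h : D.Reaches w k (conf s v st))
    (hs : D.pda.Step (conf s v st) (conf s' v' st)) : D.Reaches w k (conf s' v' st) :=
  h.step hs (fun _ => le_rfl) (fun _ => le_rfl) length_init_le

theorem Reaches.read {R : Finset (Fin m)} {p : ℕ} (hp : p < B + 1) {q : Fin (B + 1)}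
    (h : D.Reaches w k
      (conf (some (ι, i, j, R, ⟨p, hp⟩, q)) (List.replicate p i ++ v) st)) :
    D.Reaches w k (conf (some (ι, i, j, R, 0, q)) v st) := by
  induction p with
  | zero => exact h
  | succ p ih => exact ih (by omega) (Reaches.flat h (step_read _ _ (.read rfl)))

theorem Reaches.push (hk : Even k) {q : ℕ} (hq : q < B + 1) {ts : List (Fin m)}
    (hj : ∀ t ∈ ts, j ≤ t)
    (h : D.Reaches w k (conf (some (ι, i, j, ts.toFinset, 0, ⟨q, hq⟩)) v (encode ts))) :
    D.Reaches w k (conf (some (ι, i, j, (List.replicate q j ++ ts).toFinset, 0, 0)) v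
      (encode (List.replicate q j ++ ts))) := by
  induction q generalizing ts with
  | zero => exact h
  | succ q ih =>
    rw [List.replicate_succ', List.append_assoc]
    refine ih (by omega) (ts := j :: ts) (by simpa using hj) ?_
    have hs := step_push (q₀ := none) (F := final m B I) v (encode ts)
      (Move.push (D := D) (ι := ι) (i := i) (j := j) (R := ts.toFinset) (p := 0)
        (q := ⟨q + 1, hq⟩) (q' := ⟨q, by omega⟩) rfl rfl (by simpa using hj))
    rw [List.toFinset_cons]
    simp only [List.mem_toFinset] at hs
    exact h.step hs (fun _ => by simp [conf, encode]) (fun h => absurd hk h) length_init_le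

/-- Items with the current first letter are used one after another, in decreasing order of their
second letters. -/
theorem Reaches.items (hk : Even k) {l : List (Item m)} (hl : ∀ x ∈ l, x ∈ D.menu ι ∧ x.fst = i)
    (hsort : l.Pairwise fun x y => y.snd ≤ x.snd) {ts : List (Fin m)} (hts : ts.Pairwise (· ≤ ·))
    (hlt : ∀ x ∈ l, 0 < x.q → ∀ t ∈ ts, x.snd ≤ t)
    (h : D.Reaches w k (conf (some (ι, i, j, ts.toFinset, 0, 0))
      (List.replicate (l.map Item.p).sum i ++ v) (encode ts))) :
    ∃ j' ts', D.Reaches w k (conf (some (ι, i, j', ts'.toFinset, 0, 0)) v (encode ts')) ∧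
      ts'.Pairwise (· ≤ ·) ∧ (ts' : Multiset (Fin m)) = ts + (l.map Item.pushed).sum := by
  induction l generalizing j ts with
  | nil => exact ⟨j, ts, h, hts, by simp⟩
  | cons x l ih =>
    simp only [List.mem_cons, forall_eq_or_imp] at hl hlt
    rw [List.pairwise_cons] at hsort
    obtain ⟨⟨hx, rfl⟩, hl⟩ := hl
    have hp : x.p < B + 1 := Nat.lt_succ_of_le (D.p_le ι x hx)
    have hq : x.q < B + 1 := Nat.lt_succ_of_le (D.q_le ι x hx)
    rw [List.map_cons, List.sum_cons, List.replicate_add, List.append_assoc] at h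
    have h₁ := Reaches.flat h (step_nop (q₀ := none) (F := final m B I) _ _
      (Move.item (D := D) (p' := ⟨x.p, hp⟩) (q' := ⟨x.q, hq⟩) rfl rfl hx rfl rfl rfl rfl))
    have h₂ := Reaches.read hp h₁
    obtain ⟨ts₁, hts₁, h₃, hsub, he⟩ : ∃ ts₁, ts₁.Pairwise (· ≤ ·) ∧
        D.Reaches w k (conf (some (ι, x.fst, x.snd, ts₁.toFinset, 0, 0))
          (List.replicate (l.map Item.p).sum x.fst ++ v) (encode ts₁)) ∧
        (∀ t ∈ ts₁, t = x.snd ∨ t ∈ ts) ∧ (ts₁ : Multiset (Fin m)) = ts + x.pushed := by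
      rcases Nat.eq_zero_or_pos x.q with h0 | h0
      · refine ⟨ts, hts, ?_, fun t ht => .inr ht, by simp [Item.pushed, h0]⟩
        simp only [h0] at h₂
        exact h₂
      · refine ⟨_, ?_, Reaches.push hk hq (hlt.1 h0) h₂, ?_, ?_⟩
        · refine List.pairwise_append.2 ⟨List.pairwise_replicate.2 (.inr le_rfl), hts, ?_⟩
          intro a ha b hb
          rw [List.eq_of_mem_replicate ha]
          exact hlt.1 h0 b hb
        · intro t ht
          exact (List.mem_append.1 ht).imp List.eq_of_mem_replicate id
        · rw [← Multiset.coe_add, add_comm]; rfl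
    obtain ⟨j', ts', h₄, h₅, h₆⟩ := ih hl hsort.2 hts₁ (fun y hy hq t ht => by
      rcases hsub t ht with rfl | ht
      exacts [hsort.1 y hy, hlt.2 y hy hq t ht]) h₃
    refine ⟨j', ts', h₄, h₅, ?_⟩
    rw [h₆, he, List.map_cons, List.sum_cons, add_assoc]

theorem Reaches.pops (hB : 1 ≤ B) {n : ℕ} (hk : 0 < n → ¬ Even k) {ts : List (Fin m)}
    (hts : ∀ t ∈ ts, i ≤ t)
    (h : D.Reaches w k (conf (some (ι, i, j, (List.replicate n i ++ ts).toFinset, 0, 0))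
      (List.replicate n i ++ v) (encode (List.replicate n i ++ ts)))) :
    D.Reaches w k (conf (some (ι, i, j, ts.toFinset, 0, 0)) v (encode ts)) := by
  induction n with
  | zero => exact h
  | succ n ih =>
    refine ih (fun _ => hk (by omega)) (Reaches.read (p := 1) (by omega) ?_)
    have hs := step_pop (q₀ := none) (F := final m B I) (s := decide (i ∉ List.replicate n i ++ ts))
      (List.replicate (n + 1) i ++ v) (encode (List.replicate n i ++ ts))
      (Move.pop (D := D) (ι := ι) (i := i) (j := j) (R := (List.replicate (n + 1) i ++ ts).toFinset)
        (p := 0) (q := 0) (p' := ⟨1, by omega⟩) rfl rfl ?_ ?_ rfl)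
    · have e : (if decide (i ∉ List.replicate n i ++ ts) = true
          then (List.replicate (n + 1) i ++ ts).toFinset.erase i
          else (List.replicate (n + 1) i ++ ts).toFinset) =
          (List.replicate n i ++ ts).toFinset := by
        rw [List.replicate_succ, List.cons_append, List.toFinset_cons]
        split_ifs with hi
        · exact Finset.erase_insert (by simpa using hi)
        · exact Finset.insert_eq_of_mem (by simpa [or_iff_not_imp_left] using hi)
      rw [e] at hs
      exact h.step hs (fun h' => absurd h' (hk (by omega)))
        (fun _ => by simp [conf, encode, List.replicate_succ]) length_init_le
    · intro t ht
      rw [List.mem_toFinset, List.mem_append] at ht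
      rcases ht with ht | ht
      exacts [(List.eq_of_mem_replicate ht).ge, hts t ht]
    · simp [List.replicate_succ]

variable (D)

/-- A configuration reached just after the letter `i` has become current: nothing of the block of
the letters `i` has been read, and the stack holds what is due to the items used before. -/
def AtStart (w : List (Fin m)) (ι : I) (l : List (Item m)) (i : Fin m) : Prop :=
  ∃ j ts, D.Reaches w (2 * i.val - 1)
      (conf (some (ι, i, j, ts.toFinset,
        ⟨(D.base ι).count i, Nat.lt_succ_of_le (D.base_le ι i)⟩, 0))
        (w.filter (i ≤ ·)) (encode ts)) ∧
    ts.Pairwise (· ≤ ·) ∧ (ts : Multiset (Fin m)) = (due l i).filter (i ≤ ·)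

/-- A configuration reached after the block of the letters `i` has been read. -/
def AtEnd (w : List (Fin m)) (ι : I) (l : List (Item m)) (i : Fin m) : Prop :=
  ∃ j ts, D.Reaches w (2 * i.val)
      (conf (some (ι, i, j, ts.toFinset, 0, 0)) (w.filter (i < ·)) (encode ts)) ∧
    ts.Pairwise (· ≤ ·) ∧ (ts : Multiset (Fin m)) = (due l (i + 1)).filter (i < ·)

variable {D} {l : List (Item m)}

/-- In the block of the letter `i`, the stack falls while the symbols with target `i` are popped,
and rises afterwards. -/
theorem AtStart.atEnd (hB : 1 ≤ B) (hw : w.Pairwise (· ≤ ·)) (hl : ∀ x ∈ l, x ∈ D.menu ι)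
    (he : (w : Multiset (Fin m)) = D.base ι + (l.map Item.vec).sum)
    (h : D.AtStart w ι l i) : D.AtEnd w ι l i := by
  obtain ⟨j, ts, h, hts, hd⟩ := h
  have hle : ∀ t ∈ ts, i ≤ t := fun t ht => by
    have : t ∈ (ts : Multiset (Fin m)) := ht
    rw [hd] at this
    exact (Multiset.mem_filter.1 this).2
  have hmem : ∀ t ∈ ts, ∃ x ∈ l, x.fst < i ∧ 0 < x.q ∧ x.snd = t := fun t ht => by
    have : t ∈ (ts : Multiset (Fin m)) := ht
    rw [hd] at this
    obtain ⟨x, hx, hxt⟩ := mem_list_sum.1 (Multiset.mem_filter.1 this).1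
    rw [List.mem_filter, decide_eq_true_iff] at hx
    obtain ⟨hq, rfl⟩ := Multiset.mem_replicate.1 hxt
    exact ⟨x, hx.1, hx.2, Nat.pos_of_ne_zero hq, rfl⟩
  set li := l.filter fun x => x.fst = i with hli
  have hcount : w.count i = (D.base ι).count i + (ts.count i + (li.map Item.p).sum) := by
    have h₁ := congrArg (Multiset.count i) he
    rw [Multiset.count_add, count_sum_vec (fun x hx => D.fst_lt_snd ι x (hl x hx)), ← hli] at h₁
    have h₂ := congrArg (Multiset.count i) hd
    rw [Multiset.count_filter_of_pos le_rfl] at h₂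
    rw [Multiset.coe_count] at h₁ h₂
    omega
  have hsplit : ts = List.replicate (ts.count i) i ++ ts.filter (i < ·) := by
    rw [← filter_le_eq_replicate_append hts, List.filter_eq_self.2 (by simpa using hle)]
  rw [filter_le_eq_replicate_append hw, hcount, List.replicate_add, List.append_assoc,
    List.replicate_add, List.append_assoc] at h
  have h₁ := Reaches.read _ h
  generalize hn : ts.count i = n at h₁ hsplit
  rw [hsplit] at h₁
  have h₂ := Reaches.pops hB (fun hn => ?_) (fun t ht => ?_) h₁
  rotate_left
  · -- no symbol can have the first letter as its target, so `2 * i - 1` is odd here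
    have hi : i ∈ ts := List.count_pos_iff.1 (by omega)
    obtain ⟨x, -, hx, -⟩ := hmem i hi
    have : x.fst.val < i.val := hx
    rw [Nat.not_even_iff]; omega
  · simp only [List.mem_filter, decide_eq_true_iff] at ht
    exact ht.2.le
  have h₃ : D.Reaches w (2 * i.val) _ :=
    (show 2 * i.val - 1 = 2 * i.val ∨ 2 * i.val - 1 + 1 = 2 * i.val by omega).elim
      (fun e => e ▸ h₂) (fun e => e ▸ h₂.next)
  set li' := li.insertionSort fun x y => y.snd ≤ x.snd with hli'
  have hperm : li'.Perm li := List.perm_insertionSort _ _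
  have hmemli : ∀ x ∈ li', x ∈ l ∧ x.fst = i := fun x hx => by
    have := hperm.mem_iff.1 hx
    rwa [hli, List.mem_filter, decide_eq_true_iff] at this
  rw [← (hperm.map Item.p).sum_eq] at h₃
  have hsort : li'.Pairwise fun x y => y.snd ≤ x.snd := by
    have : IsTrans (Item m) fun x y => y.snd ≤ x.snd := ⟨fun _ _ _ h h' => h'.trans h⟩
    have : Std.Total fun x y : Item m => y.snd ≤ x.snd := ⟨fun x y => le_total _ _⟩
    exact List.pairwise_insertionSort _ _
  have hlt : ∀ x ∈ li', 0 < x.q → ∀ t ∈ ts.filter (i < ·), x.snd ≤ t := by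
    intro x hx hq t ht
    simp only [List.mem_filter, decide_eq_true_iff] at ht
    obtain ⟨y, hy, hyi, hyq, rfl⟩ := hmem t ht.1
    obtain ⟨hxl, rfl⟩ := hmemli x hx
    exact D.not_cross ι y (hl y hy) x (hl x hxl) hyq hq hyi ht.2
  obtain ⟨j', ts', h₄, h₅, h₆⟩ := Reaches.items (even_two_mul _)
    (fun x hx => ⟨hl x (hmemli x hx).1, (hmemli x hx).2⟩) hsort (hts.filter _) hlt h₃
  refine ⟨j', ts', h₄, h₅, ?_⟩
  rw [h₆, (hperm.map Item.pushed).sum_eq, due_succ, Multiset.filter_add, ← Multiset.filter_coe,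
    hd, Multiset.filter_filter]
  congr 1
  · exact Multiset.filter_congr fun x _ => by simpa using le_of_lt
  · refine (Multiset.filter_eq_self.2 fun a ha => ?_).symm
    obtain ⟨x, hx, hxa⟩ := mem_list_sum.1 ha
    obtain ⟨hq, rfl⟩ := Multiset.mem_replicate.1 hxa
    rw [List.mem_filter, decide_eq_true_iff] at hx
    exact hx.2 ▸ D.fst_lt_snd ι x (hl x hx.1) (Nat.pos_of_ne_zero hq)

theorem atStart_zero (hi : i.val = 0) : D.AtStart w ι l i := by
  have h₀ : D.Reaches w 0 (conf none w []) := Phased.start (c₀ := D.pda.init w)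
  have h := Reaches.flat h₀
    (step_nop (q₀ := none) (F := final m B I) _ _
      (Move.init (D := D) (ι := ι) (i := i) (j := i)
        (p := ⟨(D.base ι).count i, Nat.lt_succ_of_le (D.base_le ι i)⟩) (q := 0) hi rfl rfl))
  refine ⟨i, [], ?_, .nil, ?_⟩
  · have e : w.filter (i ≤ ·) = w := List.filter_eq_self.2 fun x _ => by
      simp [Fin.le_def, hi]
    rw [e, hi]
    exact h
  · simp [due, hi]

theorem AtEnd.atStart {i' : Fin m} (hi : i'.val = i.val + 1) (h : D.AtEnd w ι l i) :
    D.AtStart w ι l i' := by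
  obtain ⟨j, ts, h, hts, hd⟩ := h
  have hlt : ∀ x : Fin m, i < x ↔ i' ≤ x := fun x => by rw [Fin.lt_def, Fin.le_def]; omega
  refine ⟨j, ts, ?_, hts, ?_⟩
  · have hit : i ∉ ts.toFinset := by
      rw [List.mem_toFinset, ← Multiset.mem_coe, hd, Multiset.mem_filter]
      exact fun h => h.2.false
    have h₁ := Reaches.flat h (step_nop (q₀ := none) (F := final m B I) _ _
      (Move.next (D := D) (i' := i')
        (p' := ⟨(D.base ι).count i', Nat.lt_succ_of_le (D.base_le ι i')⟩) rfl rfl hit hi rfl))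
    simp only [hlt] at h₁
    rw [show 2 * i'.val - 1 = 2 * i.val + 1 by omega]
    exact h₁.next
  · rw [hd, hi]
    simp only [hlt]

theorem atEnd (hB : 1 ≤ B) (hw : w.Pairwise (· ≤ ·)) (hl : ∀ x ∈ l, x ∈ D.menu ι)
    (he : (w : Multiset (Fin m)) = D.base ι + (l.map Item.vec).sum) (i : Fin m) :
    D.AtEnd w ι l i := by
  obtain ⟨n, hn⟩ := i
  induction n with
  | zero => exact (atStart_zero rfl).atEnd hB hw hl he
  | succ n ih => exact ((ih (by omega)).atStart rfl).atEnd hB hw hl he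

variable (D)

theorem exists_reaches_final (hB : 1 ≤ B) (hm : 1 ≤ m) (hw : w ∈ D.language) :
    ∃ s ∈ final m B I, D.Reaches w (2 * (m - 1)) (conf s [] []) := by
  obtain ⟨hw, ι, l, hl, he⟩ := hw
  obtain ⟨j, ts, h, -, hd⟩ := atEnd hB hw hl he ⟨m - 1, by omega⟩
  have hlt : ∀ x : Fin m, ¬ (⟨m - 1, by omega⟩ : Fin m) < x := fun x => by
    rw [Fin.lt_def]; simp only; omega
  simp only [hlt] at h hd
  have hts : ts = [] := by simpa using hd
  subst hts
  refine ⟨_, ⟨ι, ⟨m - 1, by omega⟩, j, 0, 0, rfl, ?_, rfl, rfl⟩, by simpa [encode] using h⟩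
  simp only; omega

theorem accepts_pda (hB : 1 ≤ B) (hm : 1 ≤ m) : D.pda.accepts = D.language := by
  refine le_antisymm D.accepts_pda_le fun w hw => ?_
  obtain ⟨s, hs, h⟩ := D.exists_reaches_final hB hm hw
  exact ⟨_, h.reflTransGen, hs, rfl⟩

theorem isKTurn_pda (hB : 1 ≤ B) (hm : 1 ≤ m) : D.pda.IsKTurn (m - 1) := by
  intro w hw
  rw [D.accepts_pda hB hm] at hw
  obtain ⟨s, hs, h⟩ := D.exists_reaches_final hB hm hw
  obtain ⟨n, f, h₀, h₁, h₂, h₃⟩ := h.isKTurnSeq rfl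
  exact ⟨n, f, h₀, h₁, h₂ ▸ ⟨hs, rfl⟩, h₃⟩

end VectorFamily

end PDA

/-! ### The automaton of a letter-bounded grammar -/

theorem pairwise_of_mem_letterBoundedWords {m : ℕ} {w : List (Fin m)}
    (hw : w ∈ letterBoundedWords m) : w.Pairwise (· ≤ ·) := by
  have key : ∀ l : List (Fin m), l.Pairwise (· < ·) →
      ∀ w ∈ (l.map fun i => KStar.kstar ({[i]} : Language (Fin m))).prod,
        w.Pairwise (· ≤ ·) ∧ ∀ x ∈ w, x ∈ l := by
    intro l hl
    induction l with
    | nil =>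
      intro w hw
      obtain rfl : w = [] := hw
      simp
    | cons i l ih =>
      intro w hw
      rw [List.pairwise_cons] at hl
      rw [List.map_cons, List.prod_cons, Language.mem_mul] at hw
      obtain ⟨u, hu, v, hv, rfl⟩ := hw
      obtain ⟨h₁, h₂⟩ := ih hl.2 v hv
      obtain ⟨L, rfl, hL⟩ := Language.mem_kstar.1 hu
      have h₃ : ∀ x ∈ L.flatten, x = i := fun x hx => by
        obtain ⟨y, hy, hxy⟩ := List.mem_flatten.1 hx
        obtain rfl : y = [i] := hL y hy
        simpa using hxy
      refine ⟨List.pairwise_append.2 ⟨?_, h₁, fun a ha b hb => ?_⟩, fun x hx => ?_⟩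
      · exact List.pairwise_of_forall_mem_list fun a ha b hb => by rw [h₃ a ha, h₃ b hb]
      · rw [h₃ a ha]
        exact (hl.1 b (h₂ b hb)).le
      · rcases List.mem_append.1 hx with hx | hx
        · simp [h₃ x hx]
        · exact List.mem_cons_of_mem _ (h₂ x hx)
  exact (key _ (List.pairwise_lt_finRange m) w hw).1

namespace ContextFreeGrammar

variable {m : ℕ} {G : ContextFreeGrammar (Fin m)}

open PDA

/-- The items that describe the free loops of the set `X` of nonterminals. -/
def loopItems (G : ContextFreeGrammar (Fin m)) (X : Finset G.NT) : Set (Item m) :=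
  {x | ∃ u v, G.IsFreeLoop X u v ∧ ((u ++ v : List (Fin m)) : Multiset (Fin m)) = x.vec ∧
    (0 < x.q → x.fst < x.snd ∧ x.fst ∈ u ∧ x.snd ∈ v)}

theorem p_add_q_le {X : Finset G.NT} {x : Item m} (hx : x ∈ G.loopItems X) :
    x.p + x.q ≤ 2 ^ (2 * G.symb) := by
  obtain ⟨u, v, ⟨A, -, Z, -, -, hn⟩, he, -⟩ := hx
  have := congrArg Multiset.card he
  simp only [Multiset.coe_card, List.length_append, Item.vec, Multiset.card_add,
    Multiset.card_replicate] at this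
  omega

theorem Yields.pairwise (hG : G.language ≤ letterBoundedWords m) {w : List (Fin m)}
    {X : Finset G.NT} (h : G.Yields [.nonterminal G.initial] w X) : w.Pairwise (· ≤ ·) :=
  pairwise_of_mem_letterBoundedWords (hG (mem_language_iff_exists_yields.2 ⟨X, h⟩))

/-- Repeating a loop shows that each of its two parts consists of copies of a single letter. -/
theorem exists_loopItem (hm : 1 ≤ m) (hG : G.language ≤ letterBoundedWords m) {w : List (Fin m)}
    {X : Finset G.NT} (h : G.Yields [.nonterminal G.initial] w X) {u v : List (Fin m)}
    (hl : G.IsFreeLoop X u v) :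
    ∃ x ∈ G.loopItems X, x.vec = ((u ++ v : List (Fin m)) : Multiset (Fin m)) := by
  obtain ⟨A, hA, Z, hZ, hl', hn⟩ := id hl
  obtain ⟨w', h₁, -, h₂⟩ := h.insert_loop hA (hl'.comp hl')
  have h₃ := (h₁.pairwise hG).sublist h₂
  simp only [List.pairwise_append, List.mem_append] at h₃
  obtain ⟨⟨-, -, hu⟩, ⟨-, -, hv⟩, huv⟩ := h₃
  have hu' {a : Fin m} (ha : a ∈ u) : u = List.replicate u.length a :=
    List.eq_replicate_iff.2 ⟨rfl, fun b hb => le_antisymm (hu b hb a ha) (hu a ha b hb)⟩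
  have hv' {a : Fin m} (ha : a ∈ v) : v = List.replicate v.length a :=
    List.eq_replicate_iff.2 ⟨rfl, fun b hb => le_antisymm (hv b hb a ha) (hv a ha b hb)⟩
  have single (i : Fin m) (p : ℕ) (hp : u ++ v = List.replicate p i) :
      ∃ x ∈ G.loopItems X, x.vec = ((u ++ v : List (Fin m)) : Multiset (Fin m)) := by
    have e : (⟨i, i, p, 0⟩ : Item m).vec = ((u ++ v : List (Fin m)) : Multiset (Fin m)) := by
      rw [hp, Multiset.coe_replicate]; simp [Item.vec]
    exact ⟨_, ⟨u, v, hl, e.symm, fun h => absurd h (lt_irrefl 0)⟩, e⟩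
  rcases u.eq_nil_or_concat with rfl | ⟨u₀, a, hua⟩
  · rcases v.eq_nil_or_concat with rfl | ⟨v₀, b, hvb⟩
    · exact single ⟨0, hm⟩ 0 rfl
    · exact single b _ (hv' (by simp [hvb]))
  · have ha : a ∈ u := by simp [hua]
    rcases v.eq_nil_or_concat with rfl | ⟨v₀, b, hvb⟩
    · exact single a _ (by rw [List.append_nil]; exact hu' ha)
    · have hb : b ∈ v := by simp [hvb]
      rcases (huv a (.inl ha) b (.inl hb)).eq_or_lt with rfl | hab
      · exact single a (u.length + v.length) (by
          rw [List.replicate_add, ← hu' ha, ← hv' hb])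
      · have e : (⟨a, b, u.length, v.length⟩ : Item m).vec =
            ((u ++ v : List (Fin m)) : Multiset (Fin m)) := by
          conv_rhs => rw [hu' ha, hv' hb]
          simp only [Item.vec, ← Multiset.coe_add, Multiset.coe_replicate]
        exact ⟨_, ⟨u, v, hl, e.symm, fun _ => ⟨hab, ha, hb⟩⟩, e⟩

/-- The loops at two nonterminals of one parse tree lie side by side or nested, so that their pairs
of letters cannot cross. -/
theorem loopItems_not_cross (hG : G.language ≤ letterBoundedWords m) {w : List (Fin m)}
    {X : Finset G.NT} (h : G.Yields [.nonterminal G.initial] w X) {x y : Item m}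
    (hx : x ∈ G.loopItems X) (hy : y ∈ G.loopItems X) (hxq : 0 < x.q) (hyq : 0 < y.q)
    (h₁ : x.fst < y.fst) (h₂ : y.fst < x.snd) : y.snd ≤ x.snd := by
  obtain ⟨u, v, ⟨A, hA, Z, -, hl, -⟩, -, hx⟩ := hx
  obtain ⟨u', v', ⟨B, hB, Z', -, hl', -⟩, -, hy⟩ := hy
  obtain ⟨-, hu, hv⟩ := hx hxq
  obtain ⟨hy₁, hu', hv'⟩ := hy hyq
  obtain ⟨w', Y, hw, hs⟩ := h.insert_two_loops hA hB hl hl'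
  have hp := hw.pairwise hG
  rcases hs with hs | hs | hs | hs
  · exact absurd ((List.pairwise_append.1 (hp.sublist hs)).2.2 x.snd (by simp [hv]) y.fst
      (by simp [hu'])) h₂.not_ge
  · exact absurd ((List.pairwise_append.1 (hp.sublist hs)).2.2 y.snd (by simp [hv']) x.fst
      (by simp [hu])) (h₁.trans hy₁).not_ge
  · exact (List.pairwise_append.1 (hp.sublist hs)).2.2 y.snd (by simp [hv']) x.snd hv
  · exact absurd ((List.pairwise_append.1 ((List.pairwise_append.1 (hp.sublist hs)).1)).2.2
      y.fst hu' x.fst (by simp [hu])) h₁.not_ge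

theorem exists_loopItems (hm : 1 ≤ m) (hG : G.language ≤ letterBoundedWords m) {w : List (Fin m)}
    {X : Finset G.NT} (h : G.Yields [.nonterminal G.initial] w X)
    (l : List (List (Fin m) × List (Fin m))) (hl : ∀ p ∈ l, G.IsFreeLoop X p.1 p.2) :
    ∃ l' : List (Item m), (∀ x ∈ l', x ∈ G.loopItems X) ∧ (l'.map Item.vec).sum = loopSum l := by
  induction l with
  | nil => exact ⟨[], by simp, rfl⟩
  | cons p l ih =>
    simp only [List.mem_cons, forall_eq_or_imp] at hl
    obtain ⟨l', h₁, h₂⟩ := ih hl.2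
    obtain ⟨x, hx, hxv⟩ := exists_loopItem hm hG h hl.1
    refine ⟨x :: l', by simpa using ⟨hx, h₁⟩, ?_⟩
    rw [List.map_cons, List.sum_cons, h₂, hxv]
    simp only [loopSum, List.map_cons, List.sum_cons]

theorem exists_loops {X : Finset G.NT} (l : List (Item m)) (hl : ∀ x ∈ l, x ∈ G.loopItems X) :
    ∃ l' : List (List (Fin m) × List (Fin m)), (∀ p ∈ l', G.IsFreeLoop X p.1 p.2) ∧
      loopSum l' = (l.map Item.vec).sum := by
  induction l with
  | nil => exact ⟨[], by simp, rfl⟩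
  | cons x l ih =>
    simp only [List.mem_cons, forall_eq_or_imp] at hl
    obtain ⟨l', h₁, h₂⟩ := ih hl.2
    obtain ⟨u, v, hu, he, -⟩ := hl.1
    refine ⟨(u, v) :: l', List.forall_mem_cons.2 ⟨hu, h₁⟩, ?_⟩
    rw [List.map_cons, List.sum_cons, ← h₂, ← he]
    simp only [loopSum, List.map_cons, List.sum_cons]

/-- A bound for the entries of the base vectors and the loops. -/
def bound (G : ContextFreeGrammar (Fin m)) : ℕ := 2 ^ (2 * G.symb) * (1 + G.symb)

theorem pow_le_bound : 2 ^ (2 * G.symb) ≤ G.bound := Nat.le_mul_of_pos_right _ (by omega)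

/-- The pairs of a set of nonterminals and a bounded vector that belong to a parse tree. -/
abbrev BaseIndex (G : ContextFreeGrammar (Fin m)) : Type :=
  {x : G.lhs.powerset × (Fin m → Fin (G.bound + 1)) //
    ∃ w, G.Yields [.nonterminal G.initial] w x.1 ∧ ∀ k, w.count k = x.2 k}

open Classical in
/-- The family of the Parikh vectors of a letter-bounded grammar. -/
noncomputable def vectorFamily (G : ContextFreeGrammar (Fin m))
    (hG : G.language ≤ letterBoundedWords m) :
    VectorFamily m G.bound (Fin (Fintype.card G.BaseIndex)) where
  base ι := ((Fintype.equivFin G.BaseIndex).symm ι).2.choose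
  menu ι := G.loopItems ((Fintype.equivFin G.BaseIndex).symm ι).1.1
  base_le ι k := by
    have := ((Fintype.equivFin G.BaseIndex).symm ι).2.choose_spec.2 k
    rw [Multiset.coe_count, this]
    exact Nat.le_of_lt_succ (Fin.is_lt _)
  p_le ι x hx := by
    have := p_add_q_le hx
    have := pow_le_bound (G := G)
    omega
  q_le ι x hx := by
    have := p_add_q_le hx
    have := pow_le_bound (G := G)
    omega
  fst_lt_snd ι x hx hq := by
    obtain ⟨u, v, -, -, h⟩ := hx
    exact (h hq).1
  not_cross ι x hx y hy hxq hyq h₁ h₂ :=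
    loopItems_not_cross hG ((Fintype.equivFin G.BaseIndex).symm ι).2.choose_spec.1 hx hy hxq hyq
      h₁ h₂

theorem language_vectorFamily (hm : 1 ≤ m) (hG : G.language ≤ letterBoundedWords m) :
    (G.vectorFamily hG).language = G.language := by
  classical
  ext w
  constructor
  · rintro ⟨hw, ι, l, hl, he⟩
    obtain ⟨l', h₁, h₂⟩ := exists_loops l hl
    obtain ⟨w', h₃, h₄⟩ := ((Fintype.equivFin G.BaseIndex).symm ι).2.choose_spec.1.insert_free_loops
      l' h₁
    have h₅ : (w : Multiset (Fin m)) = w' := by rw [he, h₄, h₂]; rfl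
    rw [(Multiset.coe_eq_coe.1 h₅).eq_of_pairwise' hw (h₃.pairwise hG)]
    exact mem_language_iff_exists_yields.2 ⟨_, h₃⟩
  · intro hw
    obtain ⟨X, hX⟩ := mem_language_iff_exists_yields.1 hw
    obtain ⟨w₀, h₁, h₂, l, hl, he⟩ := hX.exists_base
    obtain ⟨l', h₃, h₄⟩ := exists_loopItems hm hG h₁ l hl
    have hXl : X.card ≤ G.symb := (Finset.card_le_card hX.subset_lhs).trans card_lhs_le
    have h₅ : w₀.length ≤ G.bound := h₂.trans (Nat.mul_le_mul_left _ (by omega))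
    let x : G.BaseIndex := ⟨(⟨X, Finset.mem_powerset.2 hX.subset_lhs⟩, fun k =>
      ⟨w₀.count k, Nat.lt_succ_of_le (List.count_le_length.trans h₅)⟩), w₀, h₁, fun _ => rfl⟩
    have hx : (x.2.choose : Multiset (Fin m)) = w₀ :=
      Multiset.ext.2 fun k => by simpa using x.2.choose_spec.2 k
    refine ⟨hX.pairwise hG, Fintype.equivFin _ x, l', fun y hy => ?_, ?_⟩
    · simp only [vectorFamily, Equiv.symm_apply_apply]
      exact h₃ y hy
    · simp only [vectorFamily, Equiv.symm_apply_apply]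
      rw [he, h₄, hx]

theorem Yields.one_le_symb {A : G.NT} {w : List (Fin m)} {X : Finset G.NT}
    (h : G.Yields [.nonterminal A] w X) : 1 ≤ G.symb := by
  cases h with
  | nonterminal hr _ _ => exact (Finset.card_pos.2 ⟨A, mem_lhs hr⟩).trans_le card_lhs_le

theorem bound_succ_le (h : 1 ≤ G.symb) : G.bound + 1 ≤ 2 ^ (4 * G.symb) := by
  have h₁ : 1 + G.symb ≤ 2 ^ G.symb := by
    have := Nat.lt_two_pow_self (n := G.symb); omega
  have h₂ : G.bound ≤ 2 ^ (3 * G.symb) := by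
    rw [show 3 * G.symb = 2 * G.symb + G.symb by ring, pow_add]
    exact Nat.mul_le_mul_left _ h₁
  have h₃ : 2 ^ (3 * G.symb + 1) ≤ 2 ^ (4 * G.symb) := Nat.pow_le_pow_right two_pos (by omega)
  have h₄ : 1 ≤ 2 ^ (3 * G.symb) := Nat.one_le_two_pow
  rw [pow_succ] at h₃
  omega

open Classical in
theorem card_baseIndex_le (h : 1 ≤ G.symb) :
    Fintype.card G.BaseIndex ≤ 2 ^ (G.symb + 4 * G.symb * m) := by
  refine (Fintype.card_subtype_le _).trans ?_
  rw [Fintype.card_prod, Fintype.card_coe, Finset.card_powerset, Fintype.card_fun,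
    Fintype.card_fin, Fintype.card_fin, pow_add, pow_mul]
  exact Nat.mul_le_mul (Nat.pow_le_pow_right two_pos card_lhs_le)
    (Nat.pow_le_pow_left (bound_succ_le h) m)

open Classical in
theorem card_state_le :
    Fintype.card (Option (VectorFamily.Ctrl m G.bound (Fin (Fintype.card G.BaseIndex)))) ≤
      2 ^ ((10 + 7 * m) * G.symb) := by
  rcases isEmpty_or_nonempty G.BaseIndex with hE | ⟨⟨x, w, hw, -⟩⟩
  · simp [Nat.one_le_two_pow]
  · have h := hw.one_le_symb
    have hm : m ≤ 2 ^ (m * G.symb) :=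
      Nat.lt_two_pow_self.le.trans (Nat.pow_le_pow_right two_pos (Nat.le_mul_of_pos_right _ h))
    have hm' : 2 ^ m ≤ 2 ^ (m * G.symb) :=
      Nat.pow_le_pow_right two_pos (Nat.le_mul_of_pos_right _ h)
    have hB := bound_succ_le h
    simp only [Fintype.card_option, Fintype.card_prod, Fintype.card_finset, Fintype.card_fin]
    have h₁ := Nat.mul_le_mul (card_baseIndex_le h) (Nat.mul_le_mul hm (Nat.mul_le_mul hm
      (Nat.mul_le_mul hm' (Nat.mul_le_mul hB hB))))
    refine (Nat.add_le_add_right h₁ 1).trans ?_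
    simp only [← pow_add]
    refine le_trans ?_ (Nat.pow_le_pow_right two_pos (show G.symb + 4 * G.symb * m +
      (m * G.symb + (m * G.symb + (m * G.symb + (4 * G.symb + 4 * G.symb)))) + 1 ≤
        (10 + 7 * m) * G.symb by nlinarith))
    rw [pow_succ]
    have : 1 ≤ 2 ^ (G.symb + 4 * G.symb * m +
      (m * G.symb + (m * G.symb + (m * G.symb + (4 * G.symb + 4 * G.symb))))) := Nat.one_le_two_pow
    omega

end ContextFreeGrammar

theorem mainTheorem2 :
    ∃ K : ℕ, ∀ m : ℕ, 1 ≤ m → ∃ C : ℕ, ∀ G : ContextFreeGrammar (Fin m),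
      G.language ≤ letterBoundedWords m →
      ∃ (Q Γ : Type) (_ : Fintype Q) (_ : Fintype Γ) (M : PDA (Fin m) Q Γ),
        M.IsNormalForm ∧
        M.accepts = G.language ∧
        M.IsKTurn (m - 1) ∧
        Fintype.card Q ≤ 2 ^ (C * G.symb) ∧
        Fintype.card Γ ≤ K := by
  classical
  -- the stack symbols are the bottom symbol and two Booleans
  refine ⟨3, fun m hm => ⟨10 + 7 * m, fun G hG => ?_⟩⟩
  have hB : 1 ≤ G.bound := Nat.one_le_two_pow.trans ContextFreeGrammar.pow_le_bound
  refine ⟨_, _, inferInstance, inferInstance, (G.vectorFamily hG).pda,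
    (G.vectorFamily hG).pda_isNormalForm, ?_, (G.vectorFamily hG).isKTurn_pda hB hm,
    ContextFreeGrammar.card_state_le, by simp⟩
  rw [PDA.VectorFamily.accepts_pda _ hB hm, ContextFreeGrammar.language_vectorFamily hm hG]
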